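/- Let $K$ be a local field of characteristic $p>0$ (a non-discrete locally compact field with a non-archimedean absolute value), $\mathcal O=\{x\in K:|x|\le 1\}$, $\mathfrak P=\{x\in K:|x|<1\}$, $\mathfrak p$ a prime element (an element of $\mathfrak P$ of maximal absolute value), and $q=p^c$ the order of $\mathcal O/\mathfrak P$. Fix $\epsilon_0=1,\epsilon_1,\dots,\epsilon_{c-1}\in\mathcal O\setminus\mathfrak P$ whose classes form a basis of $\mathcal O/\mathfrak P$ over $GF(p)$. For $0\le n<q$, $n=\sum_{i<c}a_ip^i$ with $0\le a_i<p$, put $u(n)=\big(\sum_{i<c} a_i\epsilon_i\big)\mathfrak p^{-1}$, and for $n=\sum_k b_kq^k$ with $0\le b_k<q$ put $u(n)=\sum_k u(b_k)\mathfrak p^{-k}$; let $\mathbb N_0=\{0,1,2,\dots\}$ and $\mathcal Z=\{u(n):n\in\mathbb N_0\}$. Let $dx$ be the Haar measure of $(K,+)$ with $|\mathcal O|=1$, and let $\chi$ be a continuous character of $(K,+)$ that is trivial on $\mathcal O$, nontrivial on $\mathfrak p^{-1}\mathcal O$, and satisfies $\chi(u(k)u(l))=1$ for all $k,l\in\mathbb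 N_0$. Let $f\mapsto\hat f$ be the Fourier transform on $L^2(K)$, the $L^2$-extension of $\hat f(\xi)=\int_K f(x)\overline{\chi(\xi x)}\,dx$. For $j\in\mathbb Z$ and $k\in\mathbb N_0$ let $D^jf(x)=q^{j/2}f(\mathfrak p^{-j}x)$ and $T_kf(x)=f(x-u(k))$. Let $\Psi=\{\psi_1,\dots,\psi_{q-1}\}\subset L^2(K)$ be an orthonormal multiwavelet, that is, $\{D^jT_k\psi_l: 1\le l\le q-1,\ j\in\mathbb Z,\ k\in\mathbb N_0\}$ is an orthonormal basis of $L^2(K)$, and let $V=\overline{\mathrm{span}}\{D^jT_k\psi_l: 1\le l\le q-1,\ j<0,\ k\in\mathbb N_0\}$ be its space of negative dilates. Let $m(\xi)=\dim J(\xi)$, $\xi\in\mathcal O$, be the multiplicity function of $V$, where $J$ is the range function of $V$, defined up to null sets by $J(\xi)=\{(\hat f(\xi+u(n)))_{n\in\mathbb N_0}: f\in V\}\subset\ell^2$; that is, $J(\xi)$ is the closed linear span of the vectors $(\hat f(\xi+u(n)))_{n\in\mathbb N_0}$ with $f$ in a countable dense subset of $V$. Then $\Psi$ is associated with an MRA if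 and only if $m(\xi)=1$ for a.e. $\xi\in\mathcal O$. Here $\Psi$ is associated with an MRA if its space of negative dilates $V$ satisfies: $T_kV=V$ for all $k\in\mathbb N_0$; $V\subset D^1V$; $\bigcap_{j\in\mathbb Z}D^jV=\{0\}$; $\overline{\bigcup_{j\in\mathbb Z}D^jV}=L^2(K)$; and there is $\varphi\in V$ such that $\{T_k\varphi\}_{k\in\mathbb N_0}$ is an orthonormal basis of $V$. -/

import Mathlib

open MeasureTheory Filter Topology
open scoped ENNReal

namespace LocalFieldWavelet

/-- The choices that fix the translation set of a local field `K` of characteristic `p`: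
a prime element `ϖ` (an element of the prime ideal `𝔓 = {x : ‖x‖ < 1}` of maximal absolute value),
and units `1 = ε 0, …, ε (c - 1)` of the ring of integers `𝒪 = {x : ‖x‖ ≤ 1}` whose residue
classes form a basis of the residue field `𝒪 / 𝔓` over the prime field `GF(p)`. -/
structure TranslationData (K : Type*) [NontriviallyNormedField K] (p c : ℕ) where
  /-- the prime element -/
  ϖ : K
  norm_ϖ_lt_one : ‖ϖ‖ < 1
  norm_le_norm_ϖ : ∀ x : K, ‖x‖ < 1 → ‖x‖ ≤ ‖ϖ‖
  /-- representatives of a basis of the residue field over the prime field -/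
  ε : Fin c → K
  norm_ε : ∀ i, ‖ε i‖ = 1
  ε_zero : ∀ h : 0 < c, ε ⟨0, h⟩ = 1
  basis_ε : ∀ x : K, ‖x‖ ≤ 1 → ∃! a : Fin c → Fin p, ‖x - ∑ i, ((a i : ℕ) : K) * ε i‖ < 1

section Translations

variable {K : Type*} [NontriviallyNormedField K] {p c : ℕ}

theorem TranslationData.ϖ_ne_zero (S : TranslationData K p c) : S.ϖ ≠ 0 := by
  obtain ⟨x, hx0, hx1⟩ := NormedField.exists_norm_lt_one K
  intro h
  have := S.norm_le_norm_ϖ x hx1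
  rw [h, norm_zero] at this
  exact absurd this (not_le.mpr hx0)

/-- The order `q = p ^ c` of the residue field. -/
def TranslationData.q (_S : TranslationData K p c) : ℕ := p ^ c

/-- For `0 ≤ n < q`, `n = ∑ aᵢ pⁱ` in base `p`: the element `(∑ aᵢ εᵢ) ϖ⁻¹`. -/
def TranslationData.uDigit (S : TranslationData K p c) (n : ℕ) : K :=
  (∑ i : Fin c, ((n / p ^ (i : ℕ) % p : ℕ) : K) * S.ε i) * S.ϖ⁻¹

/-- For `n = ∑ bₖ qᵏ` in base `q`: `u n = ∑ u(bₖ) ϖ⁻ᵏ`. (The digits `bₖ` with `k ≥ n` vanish.) -/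
def TranslationData.u (S : TranslationData K p c) (n : ℕ) : K :=
  ∑ k ∈ Finset.range n, S.uDigit (n / S.q ^ k % S.q) * S.ϖ⁻¹ ^ k

/-- The characters of `(K, +)` used in the Fourier transform: continuous, trivial on `𝒪`, nontrivial
on `𝔓⁻¹ = ϖ⁻¹ 𝒪`, and normalised so that `χ (u k * u l) = 1` for all `k, l`. -/
structure TranslationData.IsStandardCharacter (S : TranslationData K p c)
    (χ : AddChar K Circle) : Prop where
  continuous : Continuous χ
  trivial_on_integers : ∀ x : K, ‖x‖ ≤ 1 → χ x = 1
  nontrivial : ∃ x : K, ‖x‖ ≤ 1 ∧ χ (S.ϖ⁻¹ * x) ≠ 1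
  apply_u_mul_u : ∀ k l : ℕ, χ (S.u k * S.u l) = 1

end Translations

theorem secondCountable (K : Type*) [NontriviallyNormedField K] [LocallyCompactSpace K] :
    SecondCountableTopology K := by
  have : ProperSpace K := ProperSpace.of_locallyCompactSpace K
  infer_instance

noncomputable section L2

variable (K : Type*) [NontriviallyNormedField K] [LocallyCompactSpace K]
  [MeasurableSpace K] [BorelSpace K]

/-- The ring of integers, as a compact set with nonempty interior. -/
def integerBall : TopologicalSpace.PositiveCompacts K where
  carrier := Metric.closedBall 0 1
  isCompact' := by
    have : ProperSpace K := ProperSpace.of_locallyCompactSpace K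
    exact isCompact_closedBall 0 1
  interior_nonempty' :=
    ⟨0, Metric.ball_subset_interior_closedBall (Metric.mem_ball_self one_pos)⟩

/-- The Haar measure of `(K, +)` for which the ring of integers has measure one. -/
def haar : Measure K := Measure.addHaarMeasure (integerBall K)

instance : (haar K).IsAddHaarMeasure := by unfold haar; infer_instance

/-- The complex Hilbert space `L²(K)`. -/
abbrev L2 : Type _ := Lp ℂ 2 (haar K)

variable {K}

/-- The translate `x ↦ f (x - a)`. -/
def translate (a : K) (f : L2 K) : L2 K :=
  Lp.compMeasurePreserving (fun x => x - a)
    (by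
      have := secondCountable K
      exact measurePreserving_sub_right (haar K) a) f

theorem memLp_comp_mul {a : K} (ha : a ≠ 0) (f : L2 K) :
    MemLp (fun x => f (a * x)) 2 (haar K) := by
  have := secondCountable K
  have : ((haar K).map (fun x => a * x)).IsAddHaarMeasure :=
    AddEquiv.isAddHaarMeasure_map (haar K) (DistribMulAction.toAddEquiv K (Units.mk0 a ha))
      (continuous_const_mul a) (continuous_const_mul a⁻¹)
  have hmap := Measure.isAddLeftInvariant_eq_smul ((haar K).map (fun x => a * x)) (haar K)
  have hf : MemLp f 2 ((haar K).map (fun x => a * x)) := by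
    rw [hmap]
    exact (Lp.memLp f).smul_measure ENNReal.coe_ne_top
  exact hf.comp_of_map (measurable_const_mul a).aemeasurable

variable {p c : ℕ}

/-- The dilation `D^j f (x) = q^(j/2) f (ϖ^(-j) x)`. -/
def dilate (S : TranslationData K p c) (j : ℤ) (f : L2 K) : L2 K :=
  MemLp.toLp (fun x => (((S.q : ℝ) ^ ((j : ℝ) / 2) : ℝ) : ℂ) * f (S.ϖ ^ (-j) * x))
    ((memLp_comp_mul (zpow_ne_zero (-j) S.ϖ_ne_zero) f).const_mul _)

/-- The affine system `D^j T_k ψ_l` of `Ψ`. -/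
def affineSystem (S : TranslationData K p c) {L : ℕ} (Ψ : Fin L → L2 K) :
    Fin L × ℤ × ℕ → L2 K :=
  fun i => dilate S i.2.1 (translate (S.u i.2.2) (Ψ i.1))

/-- `Ψ` is an orthonormal multiwavelet: its affine system is an orthonormal basis of `L²(K)`. -/
def IsOrthonormalMultiwavelet (S : TranslationData K p c) {L : ℕ} (Ψ : Fin L → L2 K) : Prop :=
  Orthonormal ℂ (affineSystem S Ψ) ∧
    (Submodule.span ℂ (Set.range (affineSystem S Ψ))).topologicalClosure = ⊤

/-- The space of negative dilates of `Ψ`: the closed span of the `D^j T_k ψ_l` with `j < 0`. -/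
def negativeDilates (S : TranslationData K p c) {L : ℕ} (Ψ : Fin L → L2 K) :
    Submodule ℂ (L2 K) :=
  (Submodule.span ℂ (affineSystem S Ψ '' {i | i.2.1 < 0})).topologicalClosure

/-- The dilates `D^j V` of the core space `V` form a multiresolution analysis of `L²(K)`. -/
structure IsMRA (S : TranslationData K p c) (V : Submodule ℂ (L2 K)) : Prop where
  isClosed : IsClosed (V : Set (L2 K))
  translate_eq : ∀ k : ℕ, translate (S.u k) '' (V : Set (L2 K)) = V
  subset_dilate : (V : Set (L2 K)) ⊆ dilate S 1 '' V
  iInter_eq : ⋂ j : ℤ, dilate S j '' (V : Set (L2 K)) = {0}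
  closure_iUnion_eq : closure (⋃ j : ℤ, dilate S j '' (V : Set (L2 K))) = Set.univ
  exists_scaling : ∃ φ ∈ V, Orthonormal ℂ (fun k : ℕ => translate (S.u k) φ) ∧
    (Submodule.span ℂ (Set.range fun k : ℕ => translate (S.u k) φ)).topologicalClosure = V

/-- `Ψ` is associated with an MRA: its space of negative dilates is the core space of an MRA. -/
def IsAssociatedWithMRA (S : TranslationData K p c) {L : ℕ} (Ψ : Fin L → L2 K) : Prop :=
  IsMRA S (negativeDilates S Ψ)

/-- `F` is the Fourier transform of `f ∈ L²(K)`: the limit in `L²(K)`, as `n → ∞`, of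
`ξ ↦ ∫_{‖x‖ ≤ n} f(x) χ(-ξ x) dx`. -/
def IsFourierTransform (χ : AddChar K Circle) (f F : L2 K) : Prop :=
  Tendsto (fun n : ℕ => eLpNorm
    (fun ξ => F ξ - ∫ x in Metric.closedBall (0 : K) (n : ℝ), f x * (χ (-(ξ * x)) : ℂ) ∂(haar K))
    2 (haar K)) atTop (𝓝 0)

open Classical in
/-- The Fourier transform on `L²(K)`. (For the characters considered here the transform exists for
every `f` by Plancherel's theorem; it is unique because limits in `L²` are.) -/
def fourierL2 (χ : AddChar K Circle) (f : L2 K) : L2 K :=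
  if h : ∃ F, IsFourierTransform χ f F then h.choose else 0

open Classical in
/-- The fiber `(f̂ (ξ + u n))_n ∈ ℓ²` of `f ∈ L²(K)` at `ξ`. (The sequence is square summable for
almost every `ξ`.) -/
def fiber (S : TranslationData K p c) (χ : AddChar K Circle) (f : L2 K) (ξ : K) :
    lp (fun _ : ℕ => ℂ) 2 :=
  if h : Memℓp (fun n : ℕ => fourierL2 χ f (ξ + S.u n)) 2 then
    ⟨fun n : ℕ => fourierL2 χ f (ξ + S.u n), h⟩ else 0

/-- `J` is the range function `J ξ = {fiber of f at ξ : f ∈ V}` of `V`, up to null sets of `ξ ∈ 𝒪`.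
Since elements of `L²(K)` are defined up to null sets only, the fibers of `V` at `ξ` are taken over
a countable dense subset of `V`, followed by the closed span; other dense subsets or other
representatives change `J` on a null set only. -/
def IsRangeFunction (S : TranslationData K p c) (χ : AddChar K Circle) (V : Submodule ℂ (L2 K))
    (J : K → Submodule ℂ (lp (fun _ : ℕ => ℂ) 2)) : Prop :=
  ∃ g : ℕ → L2 K, closure (Set.range g) = (V : Set (L2 K)) ∧
    ∀ᵐ ξ ∂((haar K).restrict (Metric.closedBall 0 1)),
      J ξ = (Submodule.span ℂ (Set.range fun n => fiber S χ (g n) ξ)).topologicalClosure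

/-- `m` is the multiplicity function `m ξ = dim (J ξ)`, `ξ ∈ 𝒪`, of `V`, where `J` is the range
function of `V`; infinite dimensions are recorded as `⊤`. -/
def IsMultiplicityFunction (S : TranslationData K p c) (χ : AddChar K Circle)
    (V : Submodule ℂ (L2 K)) (m : K → ℕ∞) : Prop :=
  ∃ J, IsRangeFunction S χ V J ∧
    ∀ᵐ ξ ∂((haar K).restrict (Metric.closedBall 0 1)), m ξ = Cardinal.toENat (Module.rank ℂ (J ξ))

/-- Every closed subspace of `L²(K)` has a multiplicity function. -/
theorem exists_isMultiplicityFunction (S : TranslationData K p c) (χ : AddChar K Circle)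
    (V : Submodule ℂ (L2 K)) (hV : IsClosed (V : Set (L2 K))) :
    ∃ m, IsMultiplicityFunction S χ V m := by
  have := secondCountable K
  have : Fact ((2 : ℝ≥0∞) ≠ ∞) := ⟨by norm_num⟩
  obtain ⟨v, hv⟩ := TopologicalSpace.exists_dense_seq V
  refine ⟨_, _, ⟨fun n => v n, ?_, Eventually.of_forall fun ξ => rfl⟩,
    Eventually.of_forall fun ξ => rfl⟩
  have h1 : (Set.range fun n => (v n : L2 K)) = Subtype.val '' Set.range v := by
    rw [← Set.range_comp]; rfl
  rw [h1]
  refine Set.Subset.antisymm (hV.closure_subset_iff.mpr ?_) ?_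
  · rintro _ ⟨x, _, rfl⟩
    exact x.2
  · intro x hx
    exact image_closure_subset_closure_image continuous_subtype_val ⟨⟨x, hx⟩, hv _, rfl⟩

end L2

end LocalFieldWavelet

/-!
The proof works on the Fourier side, where translations become modulations and a translation
invariant subspace is described by the fibers `(f̂ (ξ + u n))_n` of its elements.

*Plancherel.* The functions `χ (u k * x) 1_𝒪 (x - u l)` form an orthonormal basis of `L²(K)`, the
Gabor basis. Since `χ (u k * u l) = 1`, the Fourier integral maps the vector with index `(k, l)` to
the one with index `(l', k)`, where `u l' = -u l`. The unitary operator `fourierEquiv` is therefore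
defined as a permutation of this basis, and `fourierL2_eq` identifies it with the limit of truncated
Fourier integrals. Completeness of the Gabor basis rests on the uniqueness of Fourier coefficients
on `𝒪` (`ae_eq_zero_of_forall_fourierCoeff_eq_zero`), which follows from Fubini's theorem, as the
transform of the indicator of a ball is a multiple of the indicator of a ball, and balls form a
π-system.

*Fibers.* Since `K` is tiled by the translates `u n + 𝒪`, the number `⟪T_k f, g⟫` is a Fourier
coefficient of the pointwise inner product of the fibers of `f` and `g`
(`inner_translate_eq_setIntegral`). Hence `g` is orthogonal to all translates of `f` if and only if
their fibers are orthogonal almost everywhere, and the translates of `φ` are orthonormal if and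
only if the fibers of `φ` are unit vectors almost everywhere (`orthonormal_translate_iff`).

*The equivalence.* For an orthonormal multiwavelet, all axioms of a multiresolution analysis except
for the scaling function hold automatically for the space `V` of negative dilates, mostly because
`V` is the orthogonal complement of the translation invariant span of the non-negative dilates
(`isAssociatedWithMRA_iff`). If `φ` is a scaling function, then the fibers of `V` are multiples of
the fibers of `φ` and do not all vanish, so the range function has dimension one
(`ae_rank_eq_one_of_scaling`). If the dimension is one, a measurable choice of unit vectors in the
range function is the family of fibers of a scaling function (`exists_normalised_fiber`,
`exists_scaling_of_ae_rank_eq_one`).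
-/

namespace LocalFieldWavelet

/-! ### The translation set -/

section TranslationSet

variable {K : Type*} [NontriviallyNormedField K] {p c : ℕ}

theorem norm_sub_le_max_norm [IsUltrametricDist K] (x y : K) :
    ‖x - y‖ ≤ max ‖x‖ ‖y‖ := by
  rw [sub_eq_add_neg, ← norm_neg y]
  exact IsUltrametricDist.norm_add_le_max x (-y)

namespace TranslationData

theorem norm_ϖ_pos (S : TranslationData K p c) : 0 < ‖S.ϖ‖ := norm_pos_iff.mpr S.ϖ_ne_zero

theorem uDigit_zero (S : TranslationData K p c) : S.uDigit 0 = 0 := by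
  simp [uDigit]

theorem u_zero (S : TranslationData K p c) : S.u 0 = 0 := by
  simp [u]

theorem one_lt_q [Fact p.Prime] (S : TranslationData K p c) : 1 < S.q := by
  have hp : 1 < p := (Fact.out : p.Prime).one_lt
  have hc : c ≠ 0 := by
    rintro rfl
    obtain ⟨a, ha, -⟩ := S.basis_ε 1 (by simp)
    simp at ha
  exact Nat.one_lt_pow hc hp

theorem exists_uDigit_eq [Fact p.Prime] (S : TranslationData K p c) (a : Fin c → Fin p) :
    ∃ b < S.q, S.uDigit b = (∑ i, ((a i : ℕ) : K) * S.ε i) * S.ϖ⁻¹ := by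
  refine ⟨finFunctionFinEquiv a, (finFunctionFinEquiv a).2, ?_⟩
  rw [uDigit]
  congr 1
  refine Finset.sum_congr rfl fun i _ => ?_
  rw [← finFunctionFinEquiv_symm_apply_val, Equiv.symm_apply_apply]

theorem uDigit_eq [Fact p.Prime] (S : TranslationData K p c) {b : ℕ} (hb : b < S.q) :
    S.uDigit b =
      (∑ i, ((finFunctionFinEquiv.symm (⟨b, hb⟩ : Fin (p ^ c)) i : ℕ) : K) * S.ε i) * S.ϖ⁻¹ := by
  rw [uDigit]
  congr 1

/-- The digit recursion behind `u`: the lowest digit of `q * n + b` is `b`, and multiplication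
by `ϖ⁻¹` shifts the digits of `n`. -/
theorem u_mul_add [Fact p.Prime] (S : TranslationData K p c) (n : ℕ) {b : ℕ} (hb : b < S.q) :
    S.u (S.q * n + b) = S.uDigit b + S.ϖ⁻¹ * S.u n := by
  have hq := S.one_lt_q
  rcases Nat.eq_zero_or_pos (S.q * n + b) with h | h
  · have hb0 : b = 0 := by omega
    have hn0 : n = 0 := by
      rcases Nat.mul_eq_zero.mp (show S.q * n = 0 by omega) with h | h <;> omega
    subst hb0 hn0
    simp [u_zero, uDigit_zero]
  obtain ⟨N, hN⟩ := Nat.exists_eq_succ_of_ne_zero h.ne'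
  have hnN : n ≤ N := by
    rcases Nat.eq_zero_or_pos n with h | h
    · omega
    · nlinarith
  rw [u, show S.q * n + b = N + 1 from hN, Finset.sum_range_succ',
    ← show S.q * n + b = N + 1 from hN]
  have hmod : (S.q * n + b) % S.q = b := by
    rw [Nat.mul_add_mod, Nat.mod_eq_of_lt hb]
  have hdiv : ∀ k, (S.q * n + b) / S.q ^ (k + 1) = n / S.q ^ k := fun k => by
    rw [pow_succ', ← Nat.div_div_eq_div_mul, Nat.mul_add_div (by omega), Nat.div_eq_of_lt hb,
      add_zero]
  simp only [hdiv, pow_zero, Nat.div_one, hmod, mul_one]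
  rw [add_comm, u, Finset.mul_sum]
  congr 1
  rw [← Finset.sum_subset (Finset.range_mono hnN)]
  · exact Finset.sum_congr rfl fun k _ => by ring
  · intro k _ hk
    have hk' : n ≤ k := by simpa using hk
    rw [Nat.div_eq_of_lt (hk'.trans_lt (Nat.lt_pow_self hq)), Nat.zero_mod, uDigit_zero, zero_mul]

theorem u_q_mul [Fact p.Prime] (S : TranslationData K p c) (n : ℕ) :
    S.u (S.q * n) = S.ϖ⁻¹ * S.u n := by
  have := S.u_mul_add n (b := 0) (by have := S.one_lt_q; omega)
  simpa [uDigit_zero] using this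

theorem exists_u_eq_zpow_mul [Fact p.Prime] (S : TranslationData K p c) {j : ℤ} (hj : 0 ≤ j)
    (n : ℕ) : ∃ m, S.u m = S.ϖ ^ (-j) * S.u n := by
  lift j to ℕ using hj
  induction j with
  | zero => exact ⟨n, by simp⟩
  | succ j ih =>
    obtain ⟨m, hm⟩ := ih
    refine ⟨S.q * m, ?_⟩
    rw [u_q_mul, hm, ← mul_assoc]
    congr 1
    rw [zpow_neg, zpow_neg, zpow_natCast, zpow_natCast, pow_succ, mul_inv, mul_comm]

/-- In characteristic `p`, digits are added without carry. -/
theorem exists_uDigit_add [Fact p.Prime] [CharP K p] (S : TranslationData K p c) {a b : ℕ} :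
    ∃ d < S.q, S.uDigit d = S.uDigit a + S.uDigit b := by
  have hp : 0 < p := (Fact.out : p.Prime).pos
  obtain ⟨d, hd, h⟩ := S.exists_uDigit_eq fun i =>
    ⟨(a / p ^ (i : ℕ) % p + b / p ^ (i : ℕ) % p) % p, Nat.mod_lt _ hp⟩
  refine ⟨d, hd, ?_⟩
  rw [h, uDigit, uDigit, ← add_mul, ← Finset.sum_add_distrib]
  congr 1
  refine Finset.sum_congr rfl fun i _ => ?_
  rw [← add_mul, ← Nat.cast_add]
  congr 1
  exact (CharP.cast_eq_mod K p _).symm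

theorem exists_u_add [Fact p.Prime] [CharP K p] (S : TranslationData K p c) (m n : ℕ) :
    ∃ l, S.u l = S.u m + S.u n := by
  have hq := S.one_lt_q
  induction m using Nat.strong_induction_on generalizing n with
  | _ m ih =>
    rcases Nat.eq_zero_or_pos m with rfl | hm
    · exact ⟨n, by simp [u_zero]⟩
    obtain ⟨l, hl⟩ := ih (m / S.q) (Nat.div_lt_self hm hq) (n / S.q)
    obtain ⟨d, hd, h⟩ := S.exists_uDigit_add (a := m % S.q) (b := n % S.q)
    refine ⟨S.q * l + d, ?_⟩
    rw [u_mul_add _ _ hd, h, hl]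
    conv_rhs => rw [← Nat.div_add_mod m S.q, ← Nat.div_add_mod n S.q,
      u_mul_add _ _ (Nat.mod_lt _ (by omega)), u_mul_add _ _ (Nat.mod_lt _ (by omega))]
    ring

theorem exists_u_neg [Fact p.Prime] [CharP K p] (S : TranslationData K p c) (n : ℕ) :
    ∃ l, S.u l = -S.u n := by
  have h : ∀ k : ℕ, ∃ l, S.u l = k • S.u n := by
    intro k
    induction k with
    | zero => exact ⟨0, by simp [u_zero]⟩
    | succ k ih =>
      obtain ⟨l, hl⟩ := ih
      obtain ⟨m, hm⟩ := S.exists_u_add l n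
      exact ⟨m, by rw [hm, hl, succ_nsmul]⟩
  obtain ⟨l, hl⟩ := h (p - 1)
  refine ⟨l, eq_neg_of_add_eq_zero_left ?_⟩
  rw [hl, ← succ_nsmul, Nat.sub_add_cancel (Fact.out : p.Prime).one_le, nsmul_eq_mul,
    CharP.cast_eq_zero, zero_mul]

/-- The translation set meets every class modulo `𝒪`. -/
theorem exists_norm_sub_u_le_one [Fact p.Prime] (S : TranslationData K p c) (x : K) :
    ∃ k, ‖x - S.u k‖ ≤ 1 := by
  have hϖ := S.norm_ϖ_pos
  obtain ⟨N, hN⟩ : ∃ N : ℕ, ‖S.ϖ ^ N * x‖ ≤ 1 := by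
    have h : Tendsto (fun N : ℕ => ‖S.ϖ‖ ^ N * ‖x‖) atTop (𝓝 (0 * ‖x‖)) :=
      (tendsto_pow_atTop_nhds_zero_of_lt_one hϖ.le S.norm_ϖ_lt_one).mul_const _
    rw [zero_mul] at h
    obtain ⟨N, hN⟩ := (h.eventually (gt_mem_nhds one_pos)).exists
    exact ⟨N, by rw [norm_mul, norm_pow]; exact hN.le⟩
  induction N generalizing x with
  | zero => exact ⟨0, by simpa [u_zero] using hN⟩
  | succ N ih =>
    obtain ⟨k, hk⟩ := ih (S.ϖ * x) (by rwa [← mul_assoc, ← pow_succ])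
    obtain ⟨a, ha, -⟩ := S.basis_ε _ hk
    obtain ⟨b, hb, hab⟩ := S.exists_uDigit_eq a
    refine ⟨S.q * k + b, ?_⟩
    have hx : x - S.u (S.q * k + b) =
        S.ϖ⁻¹ * (S.ϖ * x - S.u k - ∑ i, ((a i : ℕ) : K) * S.ε i) := by
      rw [u_mul_add _ _ hb, hab]
      field_simp [S.ϖ_ne_zero]
      ring
    rw [hx, norm_mul, norm_inv, inv_mul_le_iff₀ hϖ, mul_one]
    exact S.norm_le_norm_ϖ _ ha

/-- Distinct elements of the translation set represent distinct classes modulo `𝒪`. -/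
theorem eq_of_norm_u_sub_u_le_one [IsUltrametricDist K] [Fact p.Prime]
    (S : TranslationData K p c) {k l : ℕ} (h : ‖S.u k - S.u l‖ ≤ 1) : k = l := by
  have hq := S.one_lt_q
  have hϖ := S.norm_ϖ_pos
  induction hs : k + l using Nat.strong_induction_on generalizing k l with
  | _ s ih =>
    rcases Nat.eq_zero_or_pos s with h0 | hpos
    · omega
    have hk := Nat.mod_lt k (show S.q > 0 by omega)
    have hl := Nat.mod_lt l (show S.q > 0 by omega)
    set r : (b : ℕ) → b < S.q → K := fun b hb =>
      ∑ i, ((finFunctionFinEquiv.symm (⟨b, hb⟩ : Fin (p ^ c)) i : ℕ) : K) * S.ε i with hr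
    have hr1 : ∀ b hb, ‖r b hb‖ ≤ 1 := fun b hb =>
      IsUltrametricDist.norm_sum_le_of_forall_le_of_nonneg zero_le_one fun i _ => by
        rw [norm_mul, S.norm_ε, mul_one]
        exact IsUltrametricDist.norm_natCast_le_one K _
    have hdiff : S.u k - S.u l =
        S.ϖ⁻¹ * (r _ hk - r _ hl + (S.u (k / S.q) - S.u (l / S.q))) := by
      conv_lhs => rw [← Nat.div_add_mod k S.q, ← Nat.div_add_mod l S.q, u_mul_add _ _ hk,
        u_mul_add _ _ hl, uDigit_eq _ hk, uDigit_eq _ hl]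
      ring
    rw [hdiff, norm_mul, norm_inv, inv_mul_le_iff₀ hϖ, mul_one] at h
    have hrr : ‖r _ hk - r _ hl‖ ≤ 1 :=
      (norm_sub_le_max_norm _ _).trans (max_le (hr1 _ _) (hr1 _ _))
    have hdiv : k / S.q = l / S.q := by
      refine ih (k / S.q + l / S.q) ?_ ?_ rfl
      · rcases Nat.eq_zero_or_pos k with h0 | h0
        · have := Nat.div_lt_self (show 0 < l by omega) hq
          have := Nat.div_le_self k S.q
          omega
        · have := Nat.div_lt_self h0 hq
          have := Nat.div_le_self l S.q
          omega
      · have := norm_sub_le_max_norm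
          (r _ hk - r _ hl + (S.u (k / S.q) - S.u (l / S.q))) (r _ hk - r _ hl)
        rw [add_sub_cancel_left] at this
        exact this.trans (max_le (h.trans S.norm_ϖ_lt_one.le) hrr)
    rw [hdiv, sub_self, add_zero] at h
    have := (S.basis_ε (r _ hk) (hr1 _ _)).unique
      (y₁ := finFunctionFinEquiv.symm (⟨_, hk⟩ : Fin (p ^ c)))
      (y₂ := finFunctionFinEquiv.symm (⟨_, hl⟩ : Fin (p ^ c)))
      (by simp [hr]) (h.trans_lt S.norm_ϖ_lt_one)
    have hmod : k % S.q = l % S.q := by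
      exact congrArg Fin.val (finFunctionFinEquiv.symm.injective this)
    rw [← Nat.div_add_mod k S.q, ← Nat.div_add_mod l S.q, hdiv, hmod]

theorem u_injective [IsUltrametricDist K] [Fact p.Prime] (S : TranslationData K p c) :
    Function.Injective S.u :=
  fun k l h => S.eq_of_norm_u_sub_u_le_one (by simp [h])

end TranslationData

end TranslationSet

/-! ### Tiling `K` by translates of the ring of integers -/

section Tiling

variable {K : Type*} [NontriviallyNormedField K]

theorem properSpace (K : Type*) [NontriviallyNormedField K] [LocallyCompactSpace K] :
    ProperSpace K :=
  ProperSpace.of_locallyCompactSpace K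

attribute [local instance] secondCountable properSpace

variable {p c : ℕ}

theorem preimage_add_closedBall (a : K) (r : ℝ) :
    (fun x => x + a) ⁻¹' Metric.closedBall a r = Metric.closedBall 0 r := by
  ext x
  simp [dist_eq_norm]

theorem iUnion_closedBall_u [Fact p.Prime] (S : TranslationData K p c) :
    ⋃ n, Metric.closedBall (S.u n) 1 = Set.univ := by
  refine Set.eq_univ_of_forall fun x => Set.mem_iUnion.mpr ?_
  obtain ⟨k, hk⟩ := S.exists_norm_sub_u_le_one x
  exact ⟨k, by simpa [dist_eq_norm] using hk⟩

theorem pairwise_disjoint_closedBall_u [IsUltrametricDist K] [Fact p.Prime]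
    (S : TranslationData K p c) :
    Pairwise (Function.onFun Disjoint fun n => Metric.closedBall (S.u n) 1) := by
  intro k l hkl
  refine (IsUltrametricDist.closedBall_eq_or_disjoint (S.u k) (S.u l) 1).resolve_left fun h => ?_
  have : S.u k ∈ Metric.closedBall (S.u l) 1 := h ▸ Metric.mem_closedBall_self zero_le_one
  exact hkl (S.eq_of_norm_u_sub_u_le_one (by simpa [dist_eq_norm] using this))

variable [LocallyCompactSpace K] [MeasurableSpace K] [BorelSpace K]

theorem haar_integers : haar K (Metric.closedBall 0 1) = 1 :=
  Measure.addHaarMeasure_self (K₀ := integerBall K)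

theorem setLIntegral_closedBall_eq (a : K) (g : K → ℝ≥0∞) :
    ∫⁻ x in Metric.closedBall a 1, g x ∂(haar K) =
      ∫⁻ ξ in Metric.closedBall 0 1, g (ξ + a) ∂(haar K) := by
  rw [← preimage_add_closedBall a]
  exact ((measurePreserving_add_right (haar K) a).setLIntegral_comp_preimage_emb
    (measurableEmbedding_addRight a) g _).symm

theorem setIntegral_closedBall_eq (a : K) (g : K → ℂ) :
    ∫ x in Metric.closedBall a 1, g x ∂(haar K) =
      ∫ ξ in Metric.closedBall 0 1, g (ξ + a) ∂(haar K) := by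
  rw [← preimage_add_closedBall a]
  exact ((measurePreserving_add_right (haar K) a).setIntegral_preimage_emb
    (measurableEmbedding_addRight a) g _).symm

theorem ae_forall_add_u (S : TranslationData K p c) {P : K → Prop} (h : ∀ᵐ x ∂(haar K), P x) :
    ∀ᵐ ξ ∂((haar K).restrict (Metric.closedBall 0 1)), ∀ n, P (ξ + S.u n) := by
  rw [ae_all_iff]
  intro n
  exact ae_restrict_of_ae
    ((measurePreserving_add_right (haar K) (S.u n)).quasiMeasurePreserving.ae h)

theorem ae_of_ae_forall_add_u [Fact p.Prime] (S : TranslationData K p c) {P : K → Prop}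
    (h : ∀ n, ∀ᵐ ξ ∂((haar K).restrict (Metric.closedBall 0 1)), P (ξ + S.u n)) :
    ∀ᵐ x ∂(haar K), P x := by
  rw [← Measure.restrict_univ (μ := haar K), ← iUnion_closedBall_u S, ae_restrict_iUnion_iff]
  intro n
  have h1 := (measurePreserving_add_right (haar K) (-S.u n)).restrict_preimage
    (s := Metric.closedBall 0 1) Metric.isClosed_closedBall.measurableSet
  have h2 : (fun x => x + -S.u n) ⁻¹' Metric.closedBall 0 1 = Metric.closedBall (S.u n) 1 := by
    ext x
    simp [dist_eq_norm, sub_eq_add_neg]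
  rw [h2] at h1
  simpa using h1.quasiMeasurePreserving.ae (h n)

variable [IsUltrametricDist K] [Fact p.Prime]

theorem lintegral_eq_lintegral_tsum (S : TranslationData K p c) {g : K → ℝ≥0∞}
    (hg : Measurable g) :
    ∫⁻ x, g x ∂(haar K) = ∫⁻ ξ in Metric.closedBall 0 1, ∑' n, g (ξ + S.u n) ∂(haar K) := by
  rw [← setLIntegral_univ, ← iUnion_closedBall_u S,
    lintegral_iUnion (fun n => Metric.isClosed_closedBall.measurableSet)
      (pairwise_disjoint_closedBall_u S), lintegral_tsum]
  · exact tsum_congr fun n => setLIntegral_closedBall_eq _ _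
  · exact fun n => (hg.comp (measurable_add_const _)).aemeasurable

theorem integrableOn_tsum (S : TranslationData K p c) {g : K → ℂ}
    (hm : Measurable g) (hg : Integrable g (haar K)) :
    IntegrableOn (fun ξ => ∑' n, g (ξ + S.u n)) (Metric.closedBall 0 1) (haar K) := by
  refine ⟨(Measurable.tsum fun n => hm.comp (measurable_add_const _)).aestronglyMeasurable, ?_⟩
  refine lt_of_le_of_lt (lintegral_mono fun ξ => enorm_tsum_le_tsum_enorm) ?_
  rw [← lintegral_eq_lintegral_tsum S hm.enorm]
  exact hg.2

theorem integral_eq_integral_tsum (S : TranslationData K p c) {g : K → ℂ}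
    (hm : Measurable g) (hg : Integrable g (haar K)) :
    ∫ x, g x ∂(haar K) = ∫ ξ in Metric.closedBall 0 1, ∑' n, g (ξ + S.u n) ∂(haar K) := by
  rw [integral_tsum]
  · rw [← setIntegral_univ, ← iUnion_closedBall_u S,
      integral_iUnion (fun n => Metric.isClosed_closedBall.measurableSet)
        (pairwise_disjoint_closedBall_u S) hg.integrableOn]
    exact tsum_congr fun n => setIntegral_closedBall_eq _ _
  · exact fun n => (hm.comp (measurable_add_const _)).aestronglyMeasurable
  · have h1 : ∀ n, AEMeasurable (fun ξ => ‖g (ξ + S.u n)‖ₑ)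
        ((haar K).restrict (Metric.closedBall 0 1)) :=
      fun n => (hm.comp (measurable_add_const _)).enorm.aemeasurable
    rw [← lintegral_tsum h1, ← lintegral_eq_lintegral_tsum S hm.enorm]
    exact hg.2.ne

end Tiling

/-! ### Uniqueness of Fourier coefficients on the ring of integers -/

section Uniqueness

variable {K : Type*} [NontriviallyNormedField K]
  {p c : ℕ} {S : TranslationData K p c} {χ : AddChar K Circle}

attribute [local instance] secondCountable properSpace

theorem conj_apply_addChar (χ : AddChar K Circle) (x : K) :
    (starRingEnd ℂ) (χ x : ℂ) = χ (-x) := by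
  rw [AddChar.map_neg_eq_inv, Circle.coe_inv_eq_conj]

theorem TranslationData.IsStandardCharacter.apply_mul_u_eq (hχ : S.IsStandardCharacter χ) {y : K}
    {k : ℕ} (hy : ‖y - S.u k‖ ≤ 1) {ξ : K} (hξ : ‖ξ‖ ≤ 1) : χ (y * ξ) = χ (S.u k * ξ) := by
  have : y * ξ = (y - S.u k) * ξ + S.u k * ξ := by ring
  rw [this, AddChar.map_add_eq_mul, hχ.trivial_on_integers, one_mul]
  rw [norm_mul]
  exact mul_le_one₀ hy (norm_nonneg _) hξ

variable [MeasurableSpace K] [BorelSpace K]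

theorem measurable_addChar (hχ : S.IsStandardCharacter χ) (a : K) :
    Measurable fun x : K => (χ (a * x) : ℂ) :=
  (continuous_subtype_val.comp (hχ.continuous.comp (continuous_const_mul a))).measurable

variable [LocallyCompactSpace K] [IsUltrametricDist K]

theorem setIntegral_addChar_eq_zero (χ : AddChar K Circle) {x y₀ : K} {R : ℝ} (hy₀ : ‖y₀‖ ≤ R)
    (h : χ (y₀ * x) ≠ 1) : ∫ y in Metric.closedBall 0 R, (χ (y * x) : ℂ) ∂(haar K) = 0 := by
  have hI : ∫ y in Metric.closedBall 0 R, (χ (y * x) : ℂ) ∂(haar K) =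
      χ (y₀ * x) * ∫ y in Metric.closedBall 0 R, (χ (y * x) : ℂ) ∂(haar K) := by
    rw [← integral_const_mul]
    conv_lhs => rw [← (measurePreserving_add_right (haar K) y₀).setIntegral_preimage_emb
      (measurableEmbedding_addRight y₀)]
    have hpre : (fun y => y + y₀) ⁻¹' Metric.closedBall 0 R = Metric.closedBall 0 R := by
      ext y
      simp only [Set.mem_preimage, Metric.mem_closedBall, dist_zero_right]
      constructor
      · intro hy
        have := norm_sub_le_max_norm (y + y₀) y₀
        rw [add_sub_cancel_right] at this
        exact this.trans (max_le hy hy₀)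
      · intro hy
        exact (IsUltrametricDist.norm_add_le_max y y₀).trans (max_le hy hy₀)
    rw [hpre]
    refine integral_congr_ae (Eventually.of_forall fun y => ?_)
    simp only [add_mul, AddChar.map_add_eq_mul, Circle.coe_mul]
    ring
  have h1 : (1 - (χ (y₀ * x) : ℂ)) *
      ∫ y in Metric.closedBall 0 R, (χ (y * x) : ℂ) ∂(haar K) = 0 := by
    rw [sub_mul, one_mul, ← hI, sub_self]
  refine (mul_eq_zero.mp h1).resolve_left fun h2 => h ?_
  rw [sub_eq_zero] at h2
  exact Subtype.ext h2.symm

/-- The Fourier transform of the indicator of the ball of radius `‖ϖ‖⁻ⁿ` is a multiple of the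
indicator of the ball of radius `‖ϖ‖ⁿ`. -/
theorem setIntegral_addChar_eq_indicator (hχ : S.IsStandardCharacter χ) (n : ℕ) (x : K) :
    ∫ y in Metric.closedBall 0 ((‖S.ϖ‖ ^ n)⁻¹), (χ (y * x) : ℂ) ∂(haar K) =
      (Metric.closedBall 0 (‖S.ϖ‖ ^ n)).indicator
        (fun _ => ((haar K).real (Metric.closedBall 0 ((‖S.ϖ‖ ^ n)⁻¹)) : ℂ)) x := by
  have hϖ := S.norm_ϖ_pos
  by_cases hx : ‖x‖ ≤ ‖S.ϖ‖ ^ n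
  · rw [Set.indicator_of_mem (by simpa using hx)]
    have : ∀ y ∈ Metric.closedBall (0 : K) ((‖S.ϖ‖ ^ n)⁻¹), (χ (y * x) : ℂ) = 1 := fun y hy => by
      rw [hχ.trivial_on_integers, Circle.coe_one]
      rw [mem_closedBall_zero_iff] at hy
      rw [norm_mul]
      calc ‖y‖ * ‖x‖ ≤ (‖S.ϖ‖ ^ n)⁻¹ * ‖S.ϖ‖ ^ n := by gcongr
        _ = 1 := inv_mul_cancel₀ (by positivity)
    rw [setIntegral_congr_fun Metric.isClosed_closedBall.measurableSet this]
    simp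
  · rw [Set.indicator_of_notMem (by simpa using hx)]
    push Not at hx
    have hx0 : 0 < ‖x‖ := lt_of_le_of_lt (by positivity) hx
    obtain ⟨z, hz, hz1⟩ := hχ.nontrivial
    refine setIntegral_addChar_eq_zero χ (y₀ := S.ϖ⁻¹ * z / x) ?_ ?_
    · have h1 := S.norm_le_norm_ϖ (S.ϖ ^ n / x) (by
        rw [norm_div, norm_pow, div_lt_one hx0]
        exact hx)
      rw [norm_div, norm_pow, div_le_iff₀ hx0] at h1
      rw [norm_div, norm_mul, norm_inv, div_le_iff₀ hx0, inv_mul_le_iff₀ hϖ]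
      rw [mul_left_comm, le_inv_mul_iff₀ (by positivity)]
      calc ‖S.ϖ‖ ^ n * ‖z‖ ≤ ‖S.ϖ‖ ^ n * 1 := by gcongr
        _ ≤ _ := by rwa [mul_one]
    · rwa [div_mul_cancel₀ _ (norm_pos_iff.mp hx0)]

/-- An integrable function is determined by its integral and its integrals over small balls. -/
theorem ae_eq_zero_of_forall_setIntegral_closedBall (S : TranslationData K p c)
    {μ : Measure K} {h : K → ℂ} (hh : Integrable h μ) (h0 : ∫ x, h x ∂μ = 0)
    (hball : ∀ a, ∀ n : ℕ, ∫ x in Metric.closedBall a (‖S.ϖ‖ ^ n), h x ∂μ = 0) : h =ᵐ[μ] 0 := by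
  have hϖ := S.norm_ϖ_pos
  -- In an ultrametric space the balls, with the empty set, form a π-system.
  set C : Set (Set K) := insert ∅ {s | ∃ a, ∃ n : ℕ, s = Metric.closedBall a (‖S.ϖ‖ ^ n)} with hC
  have hbasis : TopologicalSpace.IsTopologicalBasis C := by
    refine TopologicalSpace.isTopologicalBasis_of_isOpen_of_nhds ?_ ?_
    · rintro _ (rfl | ⟨a, n, rfl⟩)
      · exact isOpen_empty
      · exact IsUltrametricDist.isOpen_closedBall _ (by positivity)
    · intro a u ha hu
      obtain ⟨r, hr, hru⟩ := Metric.isOpen_iff.mp hu a ha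
      obtain ⟨n, hn⟩ := exists_pow_lt_of_lt_one hr S.norm_ϖ_lt_one
      exact ⟨_, Or.inr ⟨a, n, rfl⟩, Metric.mem_closedBall_self (by positivity),
        (Metric.closedBall_subset_ball hn).trans hru⟩
  have hpi : IsPiSystem C := by
    rintro _ (rfl | ⟨a, n, rfl⟩) _ (rfl | ⟨b, m, rfl⟩) hne
    · simp [hC]
    · simp [hC]
    · simp [hC]
    · obtain ⟨x, hx1, hx2⟩ := hne
      rw [IsUltrametricDist.closedBall_eq_of_mem hx1, IsUltrametricDist.closedBall_eq_of_mem hx2]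
      rcases le_total (‖S.ϖ‖ ^ n) (‖S.ϖ‖ ^ m) with h | h
      · rw [Set.inter_eq_left.mpr (Metric.closedBall_subset_closedBall h)]
        exact Or.inr ⟨x, n, rfl⟩
      · rw [Set.inter_eq_right.mpr (Metric.closedBall_subset_closedBall h)]
        exact Or.inr ⟨x, m, rfl⟩
  refine hh.ae_eq_zero_of_forall_setIntegral_eq_zero fun s hs _ => ?_
  refine MeasurableSpace.induction_on_inter (C := fun s _ => ∫ x in s, h x ∂μ = 0)
    ((BorelSpace.measurable_eq (α := K)).trans hbasis.borel_eq_generateFrom) hpi ?_ ?_ ?_ ?_ s hs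
  · simp
  · rintro _ (rfl | ⟨a, n, rfl⟩)
    · simp
    · exact hball a n
  · intro t ht h1
    have := integral_add_compl ht hh
    rwa [h1, h0, zero_add] at this
  · intro f hd hf h1
    rw [integral_iUnion hf hd hh.integrableOn]
    simp [h1]

/-- An integrable function on the ring of integers whose Fourier coefficients with respect to the
characters `ξ ↦ χ (u k * ξ)` vanish is zero. -/
theorem ae_eq_zero_of_forall_fourierCoeff_eq_zero [Fact p.Prime] (hχ : S.IsStandardCharacter χ)
    {h : K → ℂ} (hh : IntegrableOn h (Metric.closedBall 0 1) (haar K))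
    (hcoeff : ∀ k, ∫ ξ in Metric.closedBall 0 1, (χ (S.u k * ξ) : ℂ) * h ξ ∂(haar K) = 0) :
    ∀ᵐ ξ ∂((haar K).restrict (Metric.closedBall 0 1)), h ξ = 0 := by
  have hϖ := S.norm_ϖ_pos
  -- Since `χ` is trivial on the integers, all the coefficients with `y ∈ K` vanish.
  have hall : ∀ y, ∫ ξ in Metric.closedBall 0 1, (χ (y * ξ) : ℂ) * h ξ ∂(haar K) = 0 := by
    intro y
    obtain ⟨k, hk⟩ := S.exists_norm_sub_u_le_one y
    rw [← hcoeff k]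
    refine setIntegral_congr_fun Metric.isClosed_closedBall.measurableSet fun ξ hξ => ?_
    simp only [hχ.apply_mul_u_eq hk (mem_closedBall_zero_iff.mp hξ)]
  refine ae_eq_zero_of_forall_setIntegral_closedBall S hh (by simpa using hall 0) fun a n => ?_
  have hμ : (haar K).real (Metric.closedBall 0 ((‖S.ϖ‖ ^ n)⁻¹)) ≠ 0 := by
    refine (ENNReal.toReal_pos ?_ ?_).ne'
    · exact (Metric.measure_closedBall_pos _ _ (by positivity)).ne'
    · exact (isCompact_closedBall _ _).measure_lt_top.ne
  have hprod : Integrable (Function.uncurry fun y ξ => (χ (y * (ξ - a)) : ℂ) * h ξ)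
      (((haar K).restrict (Metric.closedBall 0 ((‖S.ϖ‖ ^ n)⁻¹))).prod
        ((haar K).restrict (Metric.closedBall 0 1))) := by
    have : IsFiniteMeasure ((haar K).restrict (Metric.closedBall 0 ((‖S.ϖ‖ ^ n)⁻¹))) :=
      ⟨by simpa using (isCompact_closedBall _ _).measure_lt_top⟩
    refine (hh.integrable.comp_snd _).bdd_mul (c := 1) ?_ ?_
    · have : Continuous fun z : K × K => (χ (z.1 * (z.2 - a)) : ℂ) :=
        continuous_subtype_val.comp (hχ.continuous.comp (by fun_prop))
      exact this.aestronglyMeasurable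
    · exact Eventually.of_forall fun z => (Circle.norm_coe _).le
  have hswap := integral_integral_swap hprod
  have h1 : ∫ y in Metric.closedBall 0 ((‖S.ϖ‖ ^ n)⁻¹), ∫ ξ in Metric.closedBall 0 1,
      (χ (y * (ξ - a)) : ℂ) * h ξ ∂(haar K) ∂(haar K) = 0 := by
    refine integral_eq_zero_of_ae (Eventually.of_forall fun y => ?_)
    have : ∀ ξ, (χ (y * (ξ - a)) : ℂ) * h ξ = χ (-(y * a)) * ((χ (y * ξ) : ℂ) * h ξ) := fun ξ => by
      rw [mul_sub, sub_eq_neg_add, AddChar.map_add_eq_mul, Circle.coe_mul, mul_assoc]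
    simp only [this, integral_const_mul, hall, mul_zero, Pi.zero_apply]
  rw [h1] at hswap
  simp only [integral_mul_const, setIntegral_addChar_eq_indicator hχ] at hswap
  have h2 : ∀ ξ, (Metric.closedBall 0 (‖S.ϖ‖ ^ n)).indicator
      (fun _ => ((haar K).real (Metric.closedBall 0 ((‖S.ϖ‖ ^ n)⁻¹)) : ℂ)) (ξ - a) * h ξ =
      ((haar K).real (Metric.closedBall 0 ((‖S.ϖ‖ ^ n)⁻¹)) : ℂ) *
        (Metric.closedBall a (‖S.ϖ‖ ^ n)).indicator h ξ := fun ξ => by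
    by_cases hξ : ‖ξ - a‖ ≤ ‖S.ϖ‖ ^ n
    · rw [Set.indicator_of_mem (by simpa using hξ),
        Set.indicator_of_mem (by simpa [dist_eq_norm] using hξ)]
    · rw [Set.indicator_of_notMem (by simpa using hξ),
        Set.indicator_of_notMem (by simpa [dist_eq_norm] using hξ), zero_mul, mul_zero]
  simp only [h2, integral_const_mul] at hswap
  rw [integral_indicator Metric.isClosed_closedBall.measurableSet] at hswap
  exact (mul_eq_zero.mp hswap.symm).resolve_left (by exact_mod_cast hμ)

end Uniqueness

/-! ### The Gabor system -/

section Gabor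

variable {K : Type*} [NontriviallyNormedField K] {p c : ℕ} {S : TranslationData K p c}
  {χ : AddChar K Circle}

attribute [local instance] secondCountable properSpace

theorem addChar_neg_u_mul_u (hχ : S.IsStandardCharacter χ) (k l : ℕ) :
    χ (-(S.u k * S.u l)) = 1 := by
  rw [AddChar.map_neg_eq_inv, hχ.apply_u_mul_u, inv_one]

variable [LocallyCompactSpace K] [MeasurableSpace K] [BorelSpace K]

theorem integrableOn_addChar_mul (hχ : S.IsStandardCharacter χ) (a : K) {s : Set K} {f : K → ℂ}
    (hf : IntegrableOn f s (haar K)) :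
    IntegrableOn (fun x => (χ (a * x) : ℂ) * f x) s (haar K) :=
  hf.integrable.bdd_mul (c := 1) (measurable_addChar hχ a).aestronglyMeasurable
    (Eventually.of_forall fun _ => (Circle.norm_coe _).le)

theorem setIntegral_integers_addChar [IsUltrametricDist K] (hχ : S.IsStandardCharacter χ) (y : K) :
    ∫ ξ in Metric.closedBall 0 1, (χ (y * ξ) : ℂ) ∂(haar K) =
      (Metric.closedBall 0 1).indicator 1 y := by
  have h := setIntegral_addChar_eq_indicator hχ 0 y
  simp only [pow_zero, inv_one] at h
  simp only [mul_comm y, h, Measure.real, haar_integers]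
  simp [Set.indicator]

theorem coeFn_translate (a : K) (f : L2 K) : translate a f =ᵐ[haar K] fun x => f (x - a) :=
  Lp.coeFn_compMeasurePreserving f (measurePreserving_sub_right (haar K) a)

theorem memLp_indicator_addChar (hχ : S.IsStandardCharacter χ) (k l : ℕ) :
    MemLp ((Metric.closedBall (S.u l) 1).indicator fun x => (χ (S.u k * x) : ℂ)) 2 (haar K) := by
  have h : MemLp ((Metric.closedBall (S.u l) 1).indicator fun _ => (1 : ℂ)) 2 (haar K) :=
    memLp_indicator_const 2 Metric.isClosed_closedBall.measurableSet 1
      (Or.inr (isCompact_closedBall _ _).measure_lt_top.ne)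
  refine h.of_le ((measurable_addChar hχ _).indicator
    Metric.isClosed_closedBall.measurableSet).aestronglyMeasurable
    (Eventually.of_forall fun x => ?_)
  by_cases hx : x ∈ Metric.closedBall (S.u l) 1
  · simpa only [Set.indicator_of_mem hx, norm_one] using (Circle.norm_coe _).le
  · simp [hx]

theorem integrable_prod_fourier (hχ : S.IsStandardCharacter χ) (k l : ℕ) {g : K → ℂ}
    (hg : Integrable g (haar K)) :
    Integrable (Function.uncurry fun ξ x => (χ (-(S.u k * ξ)) : ℂ) * (g x * χ (-(ξ * x))))
      (((haar K).restrict (Metric.closedBall (S.u l) 1)).prod (haar K)) := by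
  have : IsFiniteMeasure ((haar K).restrict (Metric.closedBall (S.u l) 1)) :=
    ⟨by simpa using (isCompact_closedBall _ _).measure_lt_top⟩
  have h := (hg.comp_snd ((haar K).restrict (Metric.closedBall (S.u l) 1))).bdd_mul (c := 1)
    (f := fun z : K × K => (χ (-(S.u k * z.1)) * χ (-(z.1 * z.2)) : ℂ)) ?_ ?_
  · refine h.congr (Eventually.of_forall fun z => ?_)
    simp only [Function.uncurry]
    ring
  · have : Continuous fun z : K × K => (χ (-(S.u k * z.1)) * χ (-(z.1 * z.2)) : ℂ) :=
      (continuous_subtype_val.comp (hχ.continuous.comp (by fun_prop))).mul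
        (continuous_subtype_val.comp (hχ.continuous.comp (by fun_prop)))
    exact this.aestronglyMeasurable
  · refine Eventually.of_forall fun z => ?_
    rw [norm_mul, Circle.norm_coe, Circle.norm_coe, mul_one]

theorem memLp_truncate (f : L2 K) (n : ℕ) :
    MemLp ((Metric.closedBall (0 : K) n).indicator f) 2 (haar K) :=
  (Lp.memLp f).indicator Metric.isClosed_closedBall.measurableSet

/-- Truncations to balls converge to the function in `L²(K)`. -/
theorem tendsto_truncate (f : L2 K) : Tendsto (fun n : ℕ => eLpNorm
    (fun x => f x - (Metric.closedBall (0 : K) n).indicator f x) 2 (haar K)) atTop (𝓝 0) := by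
  have hf : ∫⁻ x, ‖f x‖ₑ ^ (2 : ℝ) ∂(haar K) ≠ ∞ := by
    have := (Lp.memLp f).eLpNorm_lt_top
    rw [eLpNorm_lt_top_iff_lintegral_rpow_enorm_lt_top (by norm_num) (by norm_num)] at this
    simpa using this.ne
  simp only [eLpNorm_eq_lintegral_rpow_enorm_toReal (show (2 : ℝ≥0∞) ≠ 0 by norm_num)
    (show (2 : ℝ≥0∞) ≠ ∞ by norm_num), ENNReal.toReal_ofNat]
  have h := tendsto_lintegral_of_dominated_convergence (μ := haar K)
    (F := fun (n : ℕ) x => ‖f x - (Metric.closedBall (0 : K) n).indicator f x‖ₑ ^ (2 : ℝ))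
    (f := 0) (fun x => ‖f x‖ₑ ^ (2 : ℝ)) (fun n => ?_) (fun n => Eventually.of_forall fun x => ?_)
    hf (Eventually.of_forall fun x => ?_)
  · have h2 := h.ennrpow_const (1 / 2)
    simpa using h2
  · exact (((Lp.stronglyMeasurable f).measurable.sub ((Lp.stronglyMeasurable f).measurable.indicator
      Metric.isClosed_closedBall.measurableSet)).enorm).pow_const _
  · by_cases hx : x ∈ Metric.closedBall (0 : K) n <;> simp [hx]
  · refine tendsto_const_nhds.congr' ?_
    obtain ⟨N, hN⟩ := exists_nat_ge ‖x‖
    filter_upwards [eventually_ge_atTop N] with n hn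
    have hx : x ∈ Metric.closedBall (0 : K) n :=
      mem_closedBall_zero_iff.mpr (hN.trans (by exact_mod_cast hn))
    simp [hx]

/-- The Gabor system `χ (u k * x) 1_𝒪 (x - u l)`. -/
noncomputable def gabor (hχ : S.IsStandardCharacter χ) (i : ℕ × ℕ) : L2 K :=
  (memLp_indicator_addChar hχ i.1 i.2).toLp _

theorem inner_gabor (hχ : S.IsStandardCharacter χ) (k l : ℕ) (f : L2 K) :
    inner ℂ (gabor hχ (k, l)) f =
      ∫ x in Metric.closedBall (S.u l) 1, (χ (-(S.u k * x)) : ℂ) * f x ∂(haar K) := by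
  rw [L2.inner_def, ← integral_indicator Metric.isClosed_closedBall.measurableSet]
  refine integral_congr_ae ?_
  filter_upwards [(memLp_indicator_addChar hχ k l).coeFn_toLp] with x hx
  rw [gabor, hx, RCLike.inner_apply]
  by_cases h : x ∈ Metric.closedBall (S.u l) 1
  · simp only [Set.indicator_of_mem h, conj_apply_addChar, mul_comm]
  · simp only [Set.indicator_of_notMem h, map_zero, mul_zero]

theorem integrableOn_closedBall (f : L2 K) (a : K) (r : ℝ) :
    IntegrableOn f (Metric.closedBall a r) (haar K) := by
  have : IsFiniteMeasure ((haar K).restrict (Metric.closedBall a r)) :=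
    ⟨by simpa using (isCompact_closedBall _ _).measure_lt_top⟩
  exact ((Lp.memLp f).restrict _).integrable one_le_two

theorem orthonormal_gabor [IsUltrametricDist K] [Fact p.Prime] (hχ : S.IsStandardCharacter χ) :
    Orthonormal ℂ (gabor hχ) := by
  classical
  rw [orthonormal_iff_ite]
  rintro ⟨k, l⟩ ⟨k', l'⟩
  rw [inner_gabor]
  have h1 : ∀ᵐ x ∂((haar K).restrict (Metric.closedBall (S.u l) 1)),
      (χ (-(S.u k * x)) : ℂ) * gabor hχ (k', l') x = (χ (-(S.u k * x)) : ℂ) *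
        (Metric.closedBall (S.u l') 1).indicator (fun x => (χ (S.u k' * x) : ℂ)) x :=
    ae_restrict_of_ae ((memLp_indicator_addChar hχ k' l').coeFn_toLp.mono fun x hx => by
      rw [gabor, hx])
  rw [integral_congr_ae h1]
  by_cases hl : l = l'
  · subst hl
    rw [setIntegral_closedBall_eq]
    have h2 : ∀ ξ ∈ Metric.closedBall (0 : K) 1, (χ (-(S.u k * (ξ + S.u l))) : ℂ) *
        (Metric.closedBall (S.u l) 1).indicator (fun x => (χ (S.u k' * x) : ℂ)) (ξ + S.u l) =
        χ ((S.u k' - S.u k) * ξ) := fun ξ hξ => by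
      rw [Set.indicator_of_mem (by simpa [dist_eq_norm] using hξ), ← Circle.coe_mul,
        ← AddChar.map_add_eq_mul,
        show -(S.u k * (ξ + S.u l)) + S.u k' * (ξ + S.u l) =
          (S.u k' - S.u k) * ξ + (S.u k' * S.u l + -(S.u k * S.u l)) by ring,
        AddChar.map_add_eq_mul, AddChar.map_add_eq_mul, hχ.apply_u_mul_u,
        addChar_neg_u_mul_u hχ, mul_one, mul_one]
    rw [setIntegral_congr_fun Metric.isClosed_closedBall.measurableSet h2,
      setIntegral_integers_addChar hχ]
    by_cases hk : k = k'
    · subst hk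
      simp
    · rw [Set.indicator_of_notMem, if_neg (by simp [hk])]
      intro h3
      exact hk (S.eq_of_norm_u_sub_u_le_one (by simpa using h3)).symm
  · rw [if_neg (by simp [hl])]
    refine setIntegral_eq_zero_of_forall_eq_zero fun x hx => ?_
    rw [Set.indicator_of_notMem (Set.disjoint_left.mp (pairwise_disjoint_closedBall_u S hl) hx),
      mul_zero]

end Gabor

/-! ### Plancherel's theorem -/

section Plancherel

variable {K : Type*} [NontriviallyNormedField K] {p c : ℕ} [Fact p.Prime] [CharP K p]

namespace TranslationData

/-- The index of `-u n` in the translation set. -/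
noncomputable def negIndex (S : TranslationData K p c) (n : ℕ) : ℕ := (S.exists_u_neg n).choose

theorem u_negIndex (S : TranslationData K p c) (n : ℕ) : S.u (S.negIndex n) = -S.u n :=
  (S.exists_u_neg n).choose_spec

variable [IsUltrametricDist K]

theorem negIndex_negIndex (S : TranslationData K p c) (n : ℕ) : S.negIndex (S.negIndex n) = n :=
  S.u_injective (by rw [u_negIndex, u_negIndex, neg_neg])

/-- The permutation of the indices of the Gabor basis that the Fourier transform induces. -/
noncomputable def gaborPerm (S : TranslationData K p c) : ℕ × ℕ ≃ ℕ × ℕ where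
  toFun i := (S.negIndex i.2, i.1)
  invFun i := (i.2, S.negIndex i.1)
  left_inv i := by simp [negIndex_negIndex]
  right_inv i := by simp [negIndex_negIndex]

end TranslationData

attribute [local instance] secondCountable properSpace

variable [LocallyCompactSpace K] [MeasurableSpace K] [BorelSpace K]
  {S : TranslationData K p c} {χ : AddChar K Circle}

variable [IsUltrametricDist K]

/-- A locally integrable function with vanishing coefficients against the Gabor system is zero. -/
theorem ae_eq_zero_of_forall_gaborCoeff_eq_zero (hχ : S.IsStandardCharacter χ) {f : K → ℂ}
    (hf : ∀ l, IntegrableOn f (Metric.closedBall (S.u l) 1) (haar K))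
    (h : ∀ k l, ∫ x in Metric.closedBall (S.u l) 1, (χ (-(S.u k * x)) : ℂ) * f x ∂(haar K) = 0) :
    f =ᵐ[haar K] 0 := by
  refine ae_of_ae_forall_add_u S fun l => ?_
  refine ae_eq_zero_of_forall_fourierCoeff_eq_zero hχ ?_ fun k => ?_
  · have h1 := hf l
    rwa [← (measurePreserving_add_right (haar K) (S.u l)).integrableOn_comp_preimage
      (measurableEmbedding_addRight _), preimage_add_closedBall] at h1
  · rw [← h (S.negIndex k) l, setIntegral_closedBall_eq (S.u l)]
    refine integral_congr_ae (Eventually.of_forall fun ξ => ?_)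
    simp only
    rw [S.u_negIndex, show -(-S.u k * (ξ + S.u l)) = S.u k * ξ + S.u k * S.u l by ring,
      AddChar.map_add_eq_mul, hχ.apply_u_mul_u, mul_one]

theorem span_gabor_orthogonal (hχ : S.IsStandardCharacter χ) :
    (Submodule.span ℂ (Set.range (gabor hχ)))ᗮ = ⊥ := by
  rw [Submodule.eq_bot_iff]
  intro f hf
  refine (Lp.eq_zero_iff_ae_eq_zero).mpr ?_
  refine ae_eq_zero_of_forall_gaborCoeff_eq_zero hχ (fun l => integrableOn_closedBall f _ _)
    fun k l => ?_
  rw [← inner_gabor hχ]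
  exact (Submodule.mem_orthogonal _ _).mp hf _ (Submodule.subset_span ⟨_, rfl⟩)

/-- The Gabor system as a Hilbert basis of `L²(K)`. -/
noncomputable def gaborBasis (hχ : S.IsStandardCharacter χ) : HilbertBasis (ℕ × ℕ) ℂ (L2 K) :=
  HilbertBasis.mkOfOrthogonalEqBot (orthonormal_gabor hχ) (span_gabor_orthogonal hχ)

/-- The Gabor basis in the order in which the Fourier transform lists it. -/
noncomputable def gaborBasisPerm (hχ : S.IsStandardCharacter χ) : HilbertBasis (ℕ × ℕ) ℂ (L2 K) :=
  HilbertBasis.mkOfOrthogonalEqBot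
    ((orthonormal_gabor hχ).comp S.gaborPerm S.gaborPerm.injective) (by
      rw [S.gaborPerm.surjective.range_comp, span_gabor_orthogonal])

/-- The Fourier transform as a unitary operator. On the Gabor system, the integral that defines the
Fourier transform permutes the basis vectors, and the operator is defined by this permutation. -/
noncomputable def fourierEquiv (hχ : S.IsStandardCharacter χ) : L2 K ≃ₗᵢ[ℂ] L2 K :=
  (gaborBasis hχ).repr.trans (gaborBasisPerm hχ).repr.symm

theorem fourierEquiv_gabor (hχ : S.IsStandardCharacter χ) (k l : ℕ) :
    fourierEquiv hχ (gabor hχ (k, l)) = gabor hχ (S.negIndex l, k) := by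
  classical
  have h1 : gabor hχ (k, l) = gaborBasis hχ (k, l) := by
    rw [gaborBasis, HilbertBasis.coe_mkOfOrthogonalEqBot]
  rw [fourierEquiv, LinearIsometryEquiv.trans_apply, h1, HilbertBasis.repr_self,
    HilbertBasis.repr_symm_single, gaborBasisPerm, HilbertBasis.coe_mkOfOrthogonalEqBot]
  rfl

theorem inner_gabor_fourierEquiv (hχ : S.IsStandardCharacter χ) (k l : ℕ) (f : L2 K) :
    inner ℂ (gabor hχ (k, l)) (fourierEquiv hχ f) = inner ℂ (gabor hχ (l, S.negIndex k)) f := by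
  conv_lhs => rw [← S.negIndex_negIndex k, ← fourierEquiv_gabor, LinearIsometryEquiv.inner_map_map]

/-- On `L¹(K) ∩ L²(K)` the unitary operator is given by the Fourier integral. -/
theorem fourierEquiv_ae_eq (hχ : S.IsStandardCharacter χ) (g : L2 K)
    (hg : Integrable g (haar K)) :
    fourierEquiv hχ g =ᵐ[haar K] fun ξ => ∫ x, g x * (χ (-(ξ * x)) : ℂ) ∂(haar K) := by
  have hint : ∀ l, IntegrableOn (fun ξ => ∫ x, g x * (χ (-(ξ * x)) : ℂ) ∂(haar K))
      (Metric.closedBall (S.u l) 1) (haar K) := fun l => by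
    have := (integrable_prod_fourier hχ 0 l hg).integral_prod_left
    simpa [IntegrableOn, S.u_zero, Function.uncurry] using this
  have h0 : (fun ξ => fourierEquiv hχ g ξ - ∫ x, g x * (χ (-(ξ * x)) : ℂ) ∂(haar K))
      =ᵐ[haar K] 0 := by
    refine ae_eq_zero_of_forall_gaborCoeff_eq_zero hχ
      (fun l => (integrableOn_closedBall _ _ _).sub (hint l)) fun k l => ?_
    have h1 := integrableOn_addChar_mul hχ (-S.u k)
      (integrableOn_closedBall (fourierEquiv hχ g) (S.u l) 1)
    have h2 := integrableOn_addChar_mul hχ (-S.u k) (hint l)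
    simp only [neg_mul] at h1 h2
    simp only [mul_sub]
    rw [integral_sub h1 h2, ← inner_gabor hχ, inner_gabor_fourierEquiv, inner_gabor, sub_eq_zero]
    simp only [← integral_const_mul]
    rw [integral_integral_swap (integrable_prod_fourier hχ k l hg),
      ← integral_indicator Metric.isClosed_closedBall.measurableSet]
    refine integral_congr_ae (Eventually.of_forall fun x => ?_)
    simp only
    rw [setIntegral_closedBall_eq]
    have h3 : ∀ ξ, (χ (-(S.u k * (ξ + S.u l))) : ℂ) * (g x * χ (-((ξ + S.u l) * x))) =
        χ (-(S.u l * x)) * g x * χ (-(S.u k + x) * ξ) := fun ξ => by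
      rw [show -(S.u k * (ξ + S.u l)) = -(S.u k * S.u l) + -S.u k * ξ by ring,
        show -((ξ + S.u l) * x) = -(S.u l * x) + -x * ξ by ring,
        show -(S.u k + x) * ξ = -S.u k * ξ + -x * ξ by ring]
      simp only [AddChar.map_add_eq_mul, addChar_neg_u_mul_u hχ, Circle.coe_mul, one_mul]
      ring
    simp only [h3, integral_const_mul, setIntegral_integers_addChar hχ]
    by_cases hx : ‖S.u k + x‖ ≤ 1
    · rw [Set.indicator_of_mem, Set.indicator_of_mem, Pi.one_apply, mul_one]
      · rw [mem_closedBall_zero_iff, norm_neg]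
        exact hx
      · rw [mem_closedBall_iff_norm, S.u_negIndex, sub_neg_eq_add, add_comm]
        exact hx
    · rw [Set.indicator_of_notMem, Set.indicator_of_notMem, mul_zero]
      · rw [mem_closedBall_zero_iff, norm_neg]
        exact hx
      · rw [mem_closedBall_iff_norm, S.u_negIndex, sub_neg_eq_add, add_comm]
        exact hx
  filter_upwards [h0] with ξ hξ
  exact sub_eq_zero.mp hξ

theorem fourierEquiv_truncate_ae_eq (hχ : S.IsStandardCharacter χ) (f : L2 K) (n : ℕ) :
    fourierEquiv hχ ((memLp_truncate f n).toLp _) =ᵐ[haar K] fun ξ =>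
      ∫ x in Metric.closedBall (0 : K) (n : ℝ), f x * (χ (-(ξ * x)) : ℂ) ∂(haar K) := by
  have hmeas : MeasurableSet (Metric.closedBall (0 : K) n) :=
    Metric.isClosed_closedBall.measurableSet
  have hcoe := (memLp_truncate f n).coeFn_toLp
  have hint : Integrable ((memLp_truncate f n).toLp _) (haar K) :=
    ((integrableOn_closedBall f 0 n).integrable_indicator hmeas).congr hcoe.symm
  filter_upwards [fourierEquiv_ae_eq hχ _ hint] with ξ h
  rw [h, ← integral_indicator hmeas]
  refine integral_congr_ae ?_
  filter_upwards [hcoe] with x hx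
  rw [hx]
  by_cases h5 : x ∈ Metric.closedBall (0 : K) n
  · simp only [Set.indicator_of_mem h5]
  · simp only [Set.indicator_of_notMem h5, zero_mul]

theorem isFourierTransform_fourierEquiv (hχ : S.IsStandardCharacter χ) (f : L2 K) :
    IsFourierTransform χ f (fourierEquiv hχ f) := by
  refine (tendsto_truncate f).congr fun n => ?_
  have h2 : (fun ξ => fourierEquiv hχ f ξ -
      ∫ x in Metric.closedBall (0 : K) (n : ℝ), f x * (χ (-(ξ * x)) : ℂ) ∂(haar K)) =ᵐ[haar K]
      ((fourierEquiv hχ (f - (memLp_truncate f n).toLp _) : L2 K) : K → ℂ) := by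
    rw [map_sub]
    filter_upwards [fourierEquiv_truncate_ae_eq hχ f n, Lp.coeFn_sub (fourierEquiv hχ f)
      (fourierEquiv hχ ((memLp_truncate f n).toLp _))] with ξ h3 h4
    rw [h4, Pi.sub_apply, h3]
  rw [eLpNorm_congr_ae h2, ← Lp.enorm_def, LinearIsometryEquiv.enorm_map, Lp.enorm_def]
  refine eLpNorm_congr_ae ?_
  filter_upwards [(memLp_truncate f n).coeFn_toLp,
    Lp.coeFn_sub f ((memLp_truncate f n).toLp _)] with x h3 h4
  rw [h4, Pi.sub_apply, h3]

theorem IsFourierTransform.unique (hχ : S.IsStandardCharacter χ) {f F G : L2 K}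
    (hF : IsFourierTransform χ f F) (hG : IsFourierTransform χ f G) : F = G := by
  have key : ∀ H : L2 K, IsFourierTransform χ f H →
      Tendsto (fun n => fourierEquiv hχ ((memLp_truncate f n).toLp _)) atTop (𝓝 H) := by
    intro H hH
    rw [tendsto_iff_edist_tendsto_0]
    refine hH.congr fun n => ?_
    rw [edist_comm, Lp.edist_def]
    refine eLpNorm_congr_ae ?_
    filter_upwards [fourierEquiv_truncate_ae_eq hχ f n] with ξ h
    rw [Pi.sub_apply, h]
  exact tendsto_nhds_unique (key F hF) (key G hG)

theorem fourierL2_eq (hχ : S.IsStandardCharacter χ) (f : L2 K) :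
    fourierL2 χ f = fourierEquiv hχ f := by
  have h : ∃ F, IsFourierTransform χ f F := ⟨_, isFourierTransform_fourierEquiv hχ f⟩
  rw [fourierL2, dif_pos h]
  exact h.choose_spec.unique hχ (isFourierTransform_fourierEquiv hχ f)

/-- The Fourier transform turns translations into modulations. -/
theorem fourierEquiv_translate (hχ : S.IsStandardCharacter χ) (j : ℕ) (f : L2 K) :
    fourierEquiv hχ (translate (S.u j) f) =ᵐ[haar K]
      fun ξ => (χ (-(S.u j * ξ)) : ℂ) * fourierEquiv hχ f ξ := by
  have h0 : (fun ξ => fourierEquiv hχ (translate (S.u j) f) ξ -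
      (χ (-(S.u j * ξ)) : ℂ) * fourierEquiv hχ f ξ) =ᵐ[haar K] 0 := by
    have hint : ∀ l, IntegrableOn (fun ξ => (χ (-(S.u j * ξ)) : ℂ) * fourierEquiv hχ f ξ)
        (Metric.closedBall (S.u l) 1) (haar K) := fun l => by
      simpa only [neg_mul] using
        integrableOn_addChar_mul hχ (-S.u j) (integrableOn_closedBall (fourierEquiv hχ f) _ _)
    refine ae_eq_zero_of_forall_gaborCoeff_eq_zero hχ
      (fun l => (integrableOn_closedBall _ _ _).sub (hint l)) fun k l => ?_
    obtain ⟨m, hm⟩ := S.exists_u_add k j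
    have h1 := integrableOn_addChar_mul hχ (-S.u k)
      (integrableOn_closedBall (fourierEquiv hχ (translate (S.u j) f)) (S.u l) 1)
    have h2 := integrableOn_addChar_mul hχ (-S.u k) (hint l)
    simp only [neg_mul] at h1 h2
    have h3 : ∀ ξ, (χ (-(S.u k * ξ)) : ℂ) * (χ (-(S.u j * ξ)) * fourierEquiv hχ f ξ) =
        χ (-(S.u m * ξ)) * fourierEquiv hχ f ξ := fun ξ => by
      rw [hm, add_mul, neg_add, AddChar.map_add_eq_mul, Circle.coe_mul, mul_assoc]
    simp only [mul_sub]
    rw [integral_sub h1 h2]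
    simp only [h3]
    rw [← inner_gabor hχ, ← inner_gabor hχ, inner_gabor_fourierEquiv, inner_gabor_fourierEquiv,
      inner_gabor, inner_gabor, sub_eq_zero]
    have h4 : ∀ᵐ x ∂((haar K).restrict (Metric.closedBall (S.u (S.negIndex k)) 1)),
        (χ (-(S.u l * x)) : ℂ) * translate (S.u j) f x = χ (-(S.u l * x)) * f (x - S.u j) :=
      ae_restrict_of_ae ((coeFn_translate (S.u j) f).mono fun x hx => by rw [hx])
    rw [integral_congr_ae h4, setIntegral_closedBall_eq (S.u (S.negIndex k)),
      setIntegral_closedBall_eq (S.u (S.negIndex m))]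
    refine integral_congr_ae (Eventually.of_forall fun ξ => ?_)
    simp only [S.u_negIndex, hm]
    rw [show ξ + -(S.u k + S.u j) = ξ + -S.u k - S.u j by ring,
      show -(S.u l * (ξ + -S.u k - S.u j)) = -(S.u l * (ξ + -S.u k)) + S.u l * S.u j by ring,
      AddChar.map_add_eq_mul, hχ.apply_u_mul_u, mul_one]
  filter_upwards [h0] with ξ hξ
  exact sub_eq_zero.mp hξ

end Plancherel

/-! ### Dilations, translations and the axioms of a multiresolution analysis -/

section Dilations

variable {K : Type*} [NontriviallyNormedField K] [LocallyCompactSpace K] [MeasurableSpace K]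
  [BorelSpace K] {p c : ℕ}

attribute [local instance] secondCountable properSpace

theorem exists_map_mul_haar {a : K} (ha : a ≠ 0) :
    ∃ r : ℝ≥0∞, r ≠ ∞ ∧ (haar K).map (fun x => a * x) = r • haar K := by
  have : ((haar K).map (fun x => a * x)).IsAddHaarMeasure :=
    AddEquiv.isAddHaarMeasure_map (haar K) (DistribMulAction.toAddEquiv K (Units.mk0 a ha))
      (continuous_const_mul a) (continuous_const_mul a⁻¹)
  exact ⟨_, ENNReal.coe_ne_top,
    Measure.isAddLeftInvariant_eq_smul ((haar K).map (fun x => a * x)) (haar K)⟩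

theorem quasiMeasurePreserving_mul {a : K} (ha : a ≠ 0) :
    Measure.QuasiMeasurePreserving (fun x => a * x) (haar K) (haar K) := by
  obtain ⟨r, -, hr⟩ := exists_map_mul_haar ha
  exact ⟨measurable_const_mul a, hr ▸ Measure.smul_absolutelyContinuous⟩

theorem coeFn_dilate (S : TranslationData K p c) (j : ℤ) (f : L2 K) :
    dilate S j f =ᵐ[haar K]
      fun x => (((S.q : ℝ) ^ ((j : ℝ) / 2) : ℝ) : ℂ) * f (S.ϖ ^ (-j) * x) :=
  MemLp.coeFn_toLp _

theorem ae_zpow_mul (S : TranslationData K p c) (j : ℤ) {P : K → Prop}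
    (h : ∀ᵐ x ∂(haar K), P x) : ∀ᵐ x ∂(haar K), P (S.ϖ ^ (-j) * x) :=
  (quasiMeasurePreserving_mul (zpow_ne_zero (-j) S.ϖ_ne_zero)).ae h

theorem exists_norm_dilate_le (S : TranslationData K p c) (j : ℤ) :
    ∃ C : ℝ, ∀ f : L2 K, ‖dilate S j f‖ ≤ C * ‖f‖ := by
  have ha := zpow_ne_zero (-j) S.ϖ_ne_zero
  obtain ⟨r, hr, hmap⟩ := exists_map_mul_haar ha
  refine ⟨‖(((S.q : ℝ) ^ ((j : ℝ) / 2) : ℝ) : ℂ)‖ * (r ^ (1 / 2 : ℝ)).toReal, fun f => ?_⟩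
  rw [Lp.norm_def, Lp.norm_def, eLpNorm_congr_ae (coeFn_dilate S j f)]
  have h1 : eLpNorm (fun x => f (S.ϖ ^ (-j) * x)) 2 (haar K) =
      r ^ (1 / 2 : ℝ) * eLpNorm f 2 (haar K) := by
    have h2 := eLpNorm_map_measure (μ := haar K) (p := 2) (f := fun x => S.ϖ ^ (-j) * x) (g := f)
      (Lp.stronglyMeasurable f).aestronglyMeasurable (measurable_const_mul _).aemeasurable
    rw [hmap, eLpNorm_smul_measure_of_ne_top (by norm_num)] at h2
    rw [Function.comp_def] at h2
    rw [← h2]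
    simp
  have h3 := eLpNorm_const_smul (μ := haar K) (p := 2) (((S.q : ℝ) ^ ((j : ℝ) / 2) : ℝ) : ℂ)
    (fun x => f (S.ϖ ^ (-j) * x))
  rw [h1] at h3
  refine le_of_eq ?_
  change (eLpNorm ((((S.q : ℝ) ^ ((j : ℝ) / 2) : ℝ) : ℂ) • fun x => f (S.ϖ ^ (-j) * x)) 2
    (haar K)).toReal = _
  rw [h3, ENNReal.toReal_mul, ENNReal.toReal_mul, toReal_enorm, mul_assoc]

/-- The dilation `D^j` as a bounded linear operator on `L²(K)`. -/
noncomputable def dilateL (S : TranslationData K p c) (j : ℤ) : L2 K →L[ℂ] L2 K :=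
  LinearMap.mkContinuousOfExistsBound
    { toFun := dilate S j
      map_add' := fun f g => by
        refine Lp.ext ?_
        filter_upwards [coeFn_dilate S j (f + g), coeFn_dilate S j f, coeFn_dilate S j g,
          Lp.coeFn_add (dilate S j f) (dilate S j g),
          ae_zpow_mul S j (Lp.coeFn_add f g)] with x h1 h2 h3 h4 h5
        rw [h1, h4, Pi.add_apply, h2, h3, h5, Pi.add_apply, mul_add]
      map_smul' := fun r f => by
        refine Lp.ext ?_
        filter_upwards [coeFn_dilate S j (r • f), coeFn_dilate S j f,
          Lp.coeFn_smul r (dilate S j f),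
          ae_zpow_mul S j (Lp.coeFn_smul r f)] with x h1 h2 h4 h5
        rw [h1, RingHom.id_apply, h4, Pi.smul_apply, h2, h5, Pi.smul_apply, smul_eq_mul,
          smul_eq_mul, mul_left_comm] }
    (exists_norm_dilate_le S j)

/-- The translation by `a` as a linear isometry of `L²(K)`. -/
noncomputable def translateLI (a : K) : L2 K →ₗᵢ[ℂ] L2 K :=
  Lp.compMeasurePreservingₗᵢ ℂ (fun x => x - a) (measurePreserving_sub_right (haar K) a)

theorem translateLI_apply (a : K) (f : L2 K) : translateLI a f = translate a f := rfl

theorem translate_translate (a b : K) (f : L2 K) :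
    translate a (translate b f) = translate (a + b) f := by
  refine Lp.ext ?_
  filter_upwards [coeFn_translate a (translate b f), coeFn_translate (a + b) f,
    (measurePreserving_sub_right (haar K) a).quasiMeasurePreserving.ae (coeFn_translate b f)]
    with x h1 h2 h3
  rw [h1, h3, h2, sub_sub]

theorem translate_zero (f : L2 K) : translate 0 f = f := by
  refine Lp.ext ?_
  filter_upwards [coeFn_translate 0 f] with x h
  rw [h, sub_zero]

theorem inner_translate_right (a : K) (f g : L2 K) :
    inner ℂ f (translate a g) = inner ℂ (translate (-a) f) g := by
  rw [← translateLI_apply a, ← (translateLI a).inner_map_map (translate (-a) f) g,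
    translateLI_apply a (translate _ f), translate_translate, add_neg_cancel, translate_zero]

theorem translate_dilate (S : TranslationData K p c) (a : K) (j : ℤ) (f : L2 K) :
    translate a (dilate S j f) = dilate S j (translate (S.ϖ ^ (-j) * a) f) := by
  refine Lp.ext ?_
  filter_upwards [coeFn_translate a (dilate S j f),
    coeFn_dilate S j (translate (S.ϖ ^ (-j) * a) f),
    (measurePreserving_sub_right (haar K) a).quasiMeasurePreserving.ae (coeFn_dilate S j f),
    ae_zpow_mul S j (coeFn_translate (S.ϖ ^ (-j) * a) f)] with x h1 h2 h3 h4
  rw [h1, h3, h2, h4, mul_sub]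

theorem dilate_zero (S : TranslationData K p c) (f : L2 K) : dilate S 0 f = f := by
  refine Lp.ext ?_
  filter_upwards [coeFn_dilate S 0 f] with x h
  rw [h]
  simp

theorem dilate_dilate [Fact p.Prime] (S : TranslationData K p c) (i j : ℤ) (f : L2 K) :
    dilate S i (dilate S j f) = dilate S (i + j) f := by
  have hq : (0 : ℝ) < S.q := by exact_mod_cast zero_lt_one.trans S.one_lt_q
  refine Lp.ext ?_
  filter_upwards [coeFn_dilate S i (dilate S j f), coeFn_dilate S (i + j) f,
    ae_zpow_mul S i (coeFn_dilate S j f)] with x h1 h2 h3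
  rw [h1, h3, h2, ← mul_assoc, ← mul_assoc, ← Complex.ofReal_mul, ← Real.rpow_add hq,
    ← zpow_add₀ S.ϖ_ne_zero]
  push_cast
  rw [add_div, neg_add_rev]

variable {S : TranslationData K p c} {L : ℕ} {Ψ : Fin L → L2 K}

theorem affineSystem_mem_negativeDilates {l : Fin L} {j : ℤ} (hj : j < 0) (k : ℕ) :
    affineSystem S Ψ (l, j, k) ∈ negativeDilates S Ψ :=
  Submodule.le_topologicalClosure _ (Submodule.subset_span ⟨_, hj, rfl⟩)

theorem inner_affineSystem_eq_zero (hΨ : IsOrthonormalMultiwavelet S Ψ) {J : ℤ} {f : L2 K}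
    (hf : f ∈ (Submodule.span ℂ (affineSystem S Ψ '' {i | i.2.1 < J})).topologicalClosure)
    {j : ℤ} (hj : J ≤ j) (l : Fin L) (k : ℕ) : inner ℂ (affineSystem S Ψ (l, j, k)) f = 0 := by
  rw [← Submodule.mem_orthogonal_singleton_iff_inner_right]
  refine Submodule.topologicalClosure_minimal _ ?_ (Submodule.isClosed_orthogonal _) hf
  rw [Submodule.span_le]
  rintro _ ⟨i, hi, rfl⟩
  rw [SetLike.mem_coe, Submodule.mem_orthogonal_singleton_iff_inner_right]
  refine hΨ.1.inner_eq_zero ?_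
  rintro rfl
  exact absurd hi (not_lt.mpr hj)

theorem eq_zero_of_forall_inner_affineSystem (hΨ : IsOrthonormalMultiwavelet S Ψ) {f : L2 K}
    (hf : ∀ i, inner ℂ (affineSystem S Ψ i) f = 0) : f = 0 := by
  have h := (Submodule.topologicalClosure_eq_top_iff).mp hΨ.2
  rw [← Submodule.mem_bot ℂ, ← h, Submodule.mem_orthogonal]
  intro g hg
  induction hg using Submodule.span_induction with
  | mem x hx => obtain ⟨i, rfl⟩ := hx; exact hf i
  | zero => exact inner_zero_left _
  | add x y _ _ hx hy => rw [inner_add_left, hx, hy, add_zero]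
  | smul a x _ hx => rw [inner_smul_left, hx, mul_zero]

/-- The space of negative dilates is the orthogonal complement of the non-negative dilates. -/
theorem mem_negativeDilates_of_forall_inner_eq_zero (hΨ : IsOrthonormalMultiwavelet S Ψ)
    {f : L2 K} (hf : ∀ l j k, 0 ≤ j → inner ℂ (affineSystem S Ψ (l, j, k)) f = 0) :
    f ∈ negativeDilates S Ψ := by
  have hc : CompleteSpace (negativeDilates S Ψ) :=
    (Submodule.isClosed_topologicalClosure _).completeSpace_coe
  obtain ⟨g, hg, h, hh, rfl⟩ := (negativeDilates S Ψ).exists_add_mem_mem_orthogonal f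
  suffices h = 0 by rwa [this, add_zero]
  refine eq_zero_of_forall_inner_affineSystem hΨ fun ⟨l, j, k⟩ => ?_
  rcases lt_or_ge j 0 with hj | hj
  · exact (Submodule.mem_orthogonal _ _).mp hh _ (affineSystem_mem_negativeDilates hj k)
  · have h1 := hf l j k hj
    rwa [inner_add_right, inner_affineSystem_eq_zero hΨ hg hj, zero_add] at h1

variable [Fact p.Prime]

theorem dilate_affineSystem (i : ℤ) (l : Fin L) (j : ℤ) (k : ℕ) :
    dilate S i (affineSystem S Ψ (l, j, k)) = affineSystem S Ψ (l, i + j, k) :=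
  dilate_dilate S i j _

theorem dilate_mem_closure_span (j : ℤ) {f : L2 K} (hf : f ∈ negativeDilates S Ψ) :
    dilate S j f ∈ (Submodule.span ℂ (affineSystem S Ψ '' {i | i.2.1 < j})).topologicalClosure := by
  have h1 := Submodule.topologicalClosure_map (dilateL S j)
    (Submodule.span ℂ (affineSystem S Ψ '' {i | i.2.1 < 0}))
    (Submodule.mem_map_of_mem (f := (dilateL S j : L2 K →ₗ[ℂ] L2 K)) hf)
  refine Submodule.topologicalClosure_mono ?_ h1
  rw [Submodule.map_span]
  refine Submodule.span_mono ?_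
  rintro _ ⟨_, ⟨⟨l, i, k⟩, hi, rfl⟩, rfl⟩
  refine ⟨(l, j + i, k), ?_, (dilate_affineSystem j l i k).symm⟩
  have hi' : i < 0 := hi
  show j + i < j
  omega

theorem translate_mem_negativeDilates [CharP K p] (hΨ : IsOrthonormalMultiwavelet S Ψ) (k : ℕ)
    {f : L2 K} (hf : f ∈ negativeDilates S Ψ) : translate (S.u k) f ∈ negativeDilates S Ψ := by
  refine mem_negativeDilates_of_forall_inner_eq_zero hΨ fun l j m hj => ?_
  obtain ⟨k', hk'⟩ := S.exists_u_eq_zpow_mul hj (S.negIndex k)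
  obtain ⟨n, hn⟩ := S.exists_u_add k' m
  have h1 : translate (-S.u k) (affineSystem S Ψ (l, j, m)) = affineSystem S Ψ (l, j, n) := by
    simp only [affineSystem]
    rw [translate_dilate, translate_translate, hn, hk', S.u_negIndex]
  rw [inner_translate_right, h1]
  exact inner_affineSystem_eq_zero hΨ hf hj l n

theorem negativeDilates_le_map_dilateL :
    negativeDilates S Ψ ≤ (negativeDilates S Ψ).map (dilateL S 1 : L2 K →ₗ[ℂ] L2 K) := by
  intro f hf
  refine ⟨dilate S (-1) f, ?_, ?_⟩
  · refine Submodule.topologicalClosure_mono (Submodule.span_mono (Set.image_mono ?_))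
      (dilate_mem_closure_span (-1) hf)
    intro i hi
    exact lt_trans (b := (-1 : ℤ)) hi (by norm_num)
  · exact (dilate_dilate S 1 (-1) f).trans (dilate_zero S f)

theorem iInter_dilate_negativeDilates (hΨ : IsOrthonormalMultiwavelet S Ψ) :
    ⋂ j : ℤ, dilate S j '' (negativeDilates S Ψ : Set (L2 K)) = {0} := by
  ext f
  rw [Set.mem_iInter, Set.mem_singleton_iff]
  constructor
  · intro h
    refine eq_zero_of_forall_inner_affineSystem hΨ fun ⟨l, j, k⟩ => ?_
    obtain ⟨g, hg, rfl⟩ := h j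
    exact inner_affineSystem_eq_zero hΨ (dilate_mem_closure_span j hg) le_rfl l k
  · rintro rfl j
    exact ⟨0, zero_mem _, map_zero (dilateL S j)⟩

theorem closure_iUnion_dilate_negativeDilates (hΨ : IsOrthonormalMultiwavelet S Ψ) :
    closure (⋃ j : ℤ, dilate S j '' (negativeDilates S Ψ : Set (L2 K))) = Set.univ := by
  set V : ℤ → Submodule ℂ (L2 K) :=
    fun j => (negativeDilates S Ψ).map (dilateL S j : L2 K →ₗ[ℂ] L2 K) with hV
  have hmono : Monotone V := by
    refine monotone_int_of_le_succ fun j => ?_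
    rintro _ ⟨f, hf, rfl⟩
    obtain ⟨g, hg, hgf⟩ := negativeDilates_le_map_dilateL hf
    refine ⟨g, hg, ?_⟩
    rw [← hgf]
    exact (dilate_dilate S j 1 g).symm
  have hU : (⋃ j : ℤ, dilate S j '' (negativeDilates S Ψ : Set (L2 K))) =
      ((⨆ j, V j : Submodule ℂ (L2 K)) : Set (L2 K)) := by
    rw [Submodule.coe_iSup_of_directed V hmono.directed_le]
    rfl
  have hle : Submodule.span ℂ (Set.range (affineSystem S Ψ)) ≤ ⨆ j, V j := by
    rw [Submodule.span_le]
    rintro _ ⟨⟨l, j, k⟩, rfl⟩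
    refine Submodule.mem_iSup_of_mem (j + 1)
      ⟨affineSystem S Ψ (l, -1, k), affineSystem_mem_negativeDilates (by norm_num) k, ?_⟩
    exact (dilate_affineSystem (j + 1) l (-1) k).trans (by rw [add_neg_cancel_right])
  rw [hU, ← Submodule.topologicalClosure_coe, Set.eq_univ_iff_forall]
  intro f
  refine Submodule.topologicalClosure_mono hle ?_
  rw [hΨ.2]
  trivial

/-- For an orthonormal multiwavelet, every axiom of a multiresolution analysis holds for the space
of negative dilates, except for the existence of a scaling function. -/
theorem isAssociatedWithMRA_iff [CharP K p] (hΨ : IsOrthonormalMultiwavelet S Ψ) :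
    IsAssociatedWithMRA S Ψ ↔
      ∃ φ ∈ negativeDilates S Ψ, Orthonormal ℂ (fun k : ℕ => translate (S.u k) φ) ∧
        (Submodule.span ℂ (Set.range fun k : ℕ => translate (S.u k) φ)).topologicalClosure =
          negativeDilates S Ψ := by
  refine ⟨fun h => h.exists_scaling, fun h => ?_⟩
  refine ⟨Submodule.isClosed_topologicalClosure _, fun k => ?_, negativeDilates_le_map_dilateL,
    iInter_dilate_negativeDilates hΨ, closure_iUnion_dilate_negativeDilates hΨ, h⟩
  refine Set.Subset.antisymm ?_ fun f hf => ?_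
  · rintro _ ⟨f, hf, rfl⟩
    exact translate_mem_negativeDilates hΨ k hf
  · refine ⟨translate (S.u (S.negIndex k)) f, translate_mem_negativeDilates hΨ _ hf, ?_⟩
    rw [translate_translate, S.u_negIndex, add_neg_cancel, translate_zero]

end Dilations

/-! ### Fibers -/

section Fibers

variable {K : Type*} [NontriviallyNormedField K] {p c : ℕ} {S : TranslationData K p c}

attribute [local instance] secondCountable properSpace

theorem two_toReal_pos : 0 < (2 : ℝ≥0∞).toReal := by norm_num

open Classical in
/-- The sequence `(F (ξ + u n))_n` as an element of `ℓ²`, or `0` if it is not square summable. -/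
noncomputable def periodFiber (S : TranslationData K p c) (F : K → ℂ) (ξ : K) :
    lp (fun _ : ℕ => ℂ) 2 :=
  if h : Memℓp (fun n : ℕ => F (ξ + S.u n)) 2 then ⟨fun n => F (ξ + S.u n), h⟩ else 0

theorem periodFiber_apply {F : K → ℂ} {ξ : K} (h : Memℓp (fun n : ℕ => F (ξ + S.u n)) 2) (n : ℕ) :
    periodFiber S F ξ n = F (ξ + S.u n) := by
  rw [periodFiber, dif_pos h]

/-- The pointwise norm of the fibers, as a measurable function that is periodic with respect to the
translation set. Where the fiber is not square summable, the series, and with it the norm, has the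
value `0`, in accordance with `periodFiber`. -/
noncomputable def periodNorm (S : TranslationData K p c) (F : K → ℂ) (x : K) : ℝ :=
  √(∑' m, ‖F (x + S.u m)‖ ^ 2)

theorem norm_periodFiber {F : K → ℂ} {ξ : K} (h : Memℓp (fun n : ℕ => F (ξ + S.u n)) 2) :
    ‖periodFiber S F ξ‖ = periodNorm S F ξ := by
  rw [periodNorm, eq_comm, Real.sqrt_eq_iff_eq_sq (tsum_nonneg fun _ => by positivity)
    (norm_nonneg _)]
  have := lp.norm_rpow_eq_tsum two_toReal_pos (periodFiber S F ξ)
  simp only [ENNReal.toReal_ofNat, Real.rpow_two, periodFiber_apply h] at this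
  exact this.symm

theorem inner_periodFiber {F G : K → ℂ} {ξ : K} (hF : Memℓp (fun n : ℕ => F (ξ + S.u n)) 2)
    (hG : Memℓp (fun n : ℕ => G (ξ + S.u n)) 2) :
    inner ℂ (periodFiber S F ξ) (periodFiber S G ξ) =
      ∑' n, inner ℂ (F (ξ + S.u n)) (G (ξ + S.u n)) := by
  rw [lp.inner_eq_tsum]
  simp only [periodFiber_apply hF, periodFiber_apply hG]

theorem enorm_periodFiber_sq {F : K → ℂ} {ξ : K} (h : Memℓp (fun n : ℕ => F (ξ + S.u n)) 2) :
    ‖periodFiber S F ξ‖ₑ ^ 2 = ∑' n, ‖F (ξ + S.u n)‖ₑ ^ 2 := by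
  have hs : Summable fun n => ‖F (ξ + S.u n)‖ ^ 2 := by
    simpa using h.summable two_toReal_pos
  have h1 : ‖periodFiber S F ξ‖ ^ 2 = ∑' n, ‖F (ξ + S.u n)‖ ^ 2 := by
    rw [norm_periodFiber h, periodNorm, Real.sq_sqrt (tsum_nonneg fun _ => by positivity)]
  rw [← ofReal_norm, ← ENNReal.ofReal_pow (norm_nonneg _), h1,
    ENNReal.ofReal_tsum_of_nonneg (fun _ => by positivity) hs]
  refine tsum_congr fun n => ?_
  rw [ENNReal.ofReal_pow (norm_nonneg _), ofReal_norm]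

section Period

variable [Fact p.Prime] [CharP K p] [IsUltrametricDist K]

/-- The permutation of the indices induced by translation of the translation set by `u n`. -/
noncomputable def TranslationData.addIndexEquiv (S : TranslationData K p c) (n : ℕ) : ℕ ≃ ℕ where
  toFun m := (S.exists_u_add n m).choose
  invFun m := (S.exists_u_add (S.negIndex n) m).choose
  left_inv m := S.u_injective (by
    rw [(S.exists_u_add _ _).choose_spec, (S.exists_u_add _ _).choose_spec, S.u_negIndex,
      neg_add_cancel_left])
  right_inv m := S.u_injective (by
    rw [(S.exists_u_add _ _).choose_spec, (S.exists_u_add _ _).choose_spec, S.u_negIndex,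
      add_neg_cancel_left])

theorem TranslationData.u_addIndexEquiv (S : TranslationData K p c) (n m : ℕ) :
    S.u (S.addIndexEquiv n m) = S.u n + S.u m :=
  (S.exists_u_add n m).choose_spec

theorem tsum_add_u_add_u {E : Type*} [AddCommMonoid E] [TopologicalSpace E]
    (S : TranslationData K p c) (h : K → E) (x : K) (n : ℕ) :
    ∑' m, h (x + S.u n + S.u m) = ∑' m, h (x + S.u m) := by
  rw [← (S.addIndexEquiv n).tsum_eq fun m => h (x + S.u m)]
  simp only [S.u_addIndexEquiv, add_assoc]

theorem periodNorm_add_u (F : K → ℂ) (x : K) (n : ℕ) :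
    periodNorm S F (x + S.u n) = periodNorm S F x := by
  rw [periodNorm, periodNorm, tsum_add_u_add_u S fun y => ‖F y‖ ^ 2]

end Period

variable [MeasurableSpace K] [BorelSpace K]

theorem measurable_periodNorm [LocallyCompactSpace K] {F : K → ℂ} (hF : Measurable F) :
    Measurable (periodNorm S F) :=
  (Measurable.tsum fun _ => (hF.comp (measurable_add_const _)).norm.pow_const 2).sqrt

variable [LocallyCompactSpace K]

theorem memLp_two_iff_lintegral {F : K → ℂ} (hF : Measurable F) :
    MemLp F 2 (haar K) ↔ ∫⁻ x, ‖F x‖ₑ ^ 2 ∂(haar K) < ∞ := by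
  have h := eLpNorm_lt_top_iff_lintegral_rpow_enorm_lt_top (μ := haar K) (f := F) (p := 2)
    (by norm_num) (by norm_num)
  simp only [ENNReal.toReal_ofNat, ENNReal.rpow_two] at h
  rw [← h]
  exact ⟨fun h => h.2, fun h => ⟨hF.aestronglyMeasurable, h⟩⟩

variable [Fact p.Prime] [IsUltrametricDist K]

theorem lintegral_enorm_sq_eq (S : TranslationData K p c) {F : K → ℂ} (hF : Measurable F) :
    ∫⁻ x, ‖F x‖ₑ ^ 2 ∂(haar K) =
      ∫⁻ ξ in Metric.closedBall 0 1, ∑' n, ‖F (ξ + S.u n)‖ₑ ^ 2 ∂(haar K) :=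
  lintegral_eq_lintegral_tsum S (hF.enorm.pow_const 2)

theorem memLp_of_lintegral_periodFiber {F : K → ℂ} (S : TranslationData K p c)
    (hF : Measurable F)
    (h : ∫⁻ ξ in Metric.closedBall 0 1, ∑' n, ‖F (ξ + S.u n)‖ₑ ^ 2 ∂(haar K) < ∞) :
    MemLp F 2 (haar K) := by
  rwa [memLp_two_iff_lintegral hF, lintegral_enorm_sq_eq S hF]

theorem ae_memℓp_period (S : TranslationData K p c) (F : L2 K) :
    ∀ᵐ ξ ∂((haar K).restrict (Metric.closedBall 0 1)),
      Memℓp (fun n : ℕ => F (ξ + S.u n)) 2 := by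
  have hF := (Lp.stronglyMeasurable F).measurable
  have h1 := (memLp_two_iff_lintegral hF).mp (Lp.memLp F)
  rw [lintegral_enorm_sq_eq S hF] at h1
  filter_upwards [ae_lt_top (Measurable.tsum fun n =>
    (hF.comp (measurable_add_const (S.u n))).enorm.pow_const 2) h1.ne] with ξ hξ
  refine memℓp_gen ?_
  simp only [Function.comp_apply, enorm_eq_nnnorm, ← ENNReal.coe_pow] at hξ
  rw [lt_top_iff_ne_top, ENNReal.tsum_coe_ne_top_iff_summable, ← NNReal.summable_coe] at hξ
  simpa using hξ

variable {χ : AddChar K Circle}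

theorem setIntegral_integers_addChar_u (hχ : S.IsStandardCharacter χ) (k : ℕ) :
    ∫ ξ in Metric.closedBall 0 1, (χ (S.u k * ξ) : ℂ) ∂(haar K) = if k = 0 then 1 else 0 := by
  rw [setIntegral_integers_addChar hχ]
  by_cases hk : k = 0
  · simp [hk, S.u_zero]
  · rw [if_neg hk, Set.indicator_of_notMem]
    rw [mem_closedBall_zero_iff]
    intro h
    exact hk (S.eq_of_norm_u_sub_u_le_one (l := 0) (by rwa [S.u_zero, sub_zero]))

variable [CharP K p]

theorem fiber_eq_periodFiber (hχ : S.IsStandardCharacter χ) (f : L2 K) (ξ : K) :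
    fiber S χ f ξ = periodFiber S (fourierEquiv hχ f) ξ := by
  rw [fiber, periodFiber, fourierL2_eq hχ]

theorem ae_fiber_apply (hχ : S.IsStandardCharacter χ) (f : L2 K) :
    ∀ᵐ ξ ∂((haar K).restrict (Metric.closedBall 0 1)),
      ∀ n, fiber S χ f ξ n = fourierEquiv hχ f (ξ + S.u n) := by
  filter_upwards [ae_memℓp_period S (fourierEquiv hχ f)] with ξ hξ n
  rw [fiber_eq_periodFiber hχ, periodFiber_apply hξ]

theorem ae_inner_fiber (hχ : S.IsStandardCharacter χ) (f g : L2 K) :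
    ∀ᵐ ξ ∂((haar K).restrict (Metric.closedBall 0 1)),
      inner ℂ (fiber S χ f ξ) (fiber S χ g ξ) =
        ∑' n, inner ℂ (fourierEquiv hχ f (ξ + S.u n)) (fourierEquiv hχ g (ξ + S.u n)) := by
  filter_upwards [ae_memℓp_period S (fourierEquiv hχ f), ae_memℓp_period S (fourierEquiv hχ g)]
    with ξ hf hg
  rw [fiber_eq_periodFiber hχ, fiber_eq_periodFiber hχ, inner_periodFiber hf hg]

theorem integrableOn_inner_fiber (hχ : S.IsStandardCharacter χ) (f g : L2 K) :
    IntegrableOn (fun ξ => inner ℂ (fiber S χ f ξ) (fiber S χ g ξ)) (Metric.closedBall 0 1)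
      (haar K) := by
  have hm : Measurable fun x => (inner ℂ (fourierEquiv hχ f x) (fourierEquiv hχ g x) : ℂ) :=
    (Lp.stronglyMeasurable (fourierEquiv hχ f)).measurable.inner
      (Lp.stronglyMeasurable (fourierEquiv hχ g)).measurable
  exact (integrableOn_tsum S hm (L2.integrable_inner _ _)).congr
    ((ae_inner_fiber hχ f g).mono fun _ h => h.symm)

/-- The inner products of `g` with the translates of `f` are the Fourier coefficients of the
pointwise inner product of the fibers. -/
theorem inner_translate_eq_setIntegral (hχ : S.IsStandardCharacter χ) (f g : L2 K) (k : ℕ) :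
    inner ℂ (translate (S.u k) f) g = ∫ ξ in Metric.closedBall 0 1,
      (χ (S.u k * ξ) : ℂ) * inner ℂ (fiber S χ f ξ) (fiber S χ g ξ) ∂(haar K) := by
  have hm : Measurable fun x => (χ (S.u k * x) : ℂ) *
      (inner ℂ (fourierEquiv hχ f x) (fourierEquiv hχ g x) : ℂ) :=
    (measurable_addChar hχ _).mul ((Lp.stronglyMeasurable (fourierEquiv hχ f)).measurable.inner
      (Lp.stronglyMeasurable (fourierEquiv hχ g)).measurable)
  have hi : Integrable (fun x => (χ (S.u k * x) : ℂ) *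
      (inner ℂ (fourierEquiv hχ f x) (fourierEquiv hχ g x) : ℂ)) (haar K) :=
    (L2.integrable_inner _ _).bdd_mul (c := 1) (measurable_addChar hχ _).aestronglyMeasurable
      (Eventually.of_forall fun _ => (Circle.norm_coe _).le)
  rw [← (fourierEquiv hχ).inner_map_map, L2.inner_def]
  have h1 : ∀ᵐ x ∂(haar K),
      inner ℂ (fourierEquiv hχ (translate (S.u k) f) x) (fourierEquiv hχ g x) =
        (χ (S.u k * x) : ℂ) * (inner ℂ (fourierEquiv hχ f x) (fourierEquiv hχ g x) : ℂ) := by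
    filter_upwards [fourierEquiv_translate hχ k f] with x hx
    rw [hx, RCLike.inner_apply, RCLike.inner_apply, map_mul, conj_apply_addChar, neg_neg]
    ring
  rw [integral_congr_ae h1, integral_eq_integral_tsum S hm hi]
  refine integral_congr_ae ?_
  filter_upwards [ae_inner_fiber hχ f g] with ξ hξ
  rw [hξ, ← tsum_mul_left]
  refine tsum_congr fun n => ?_
  rw [mul_add, AddChar.map_add_eq_mul, hχ.apply_u_mul_u, mul_one]

theorem inner_eq_setIntegral (hχ : S.IsStandardCharacter χ) (f g : L2 K) :
    inner ℂ f g = ∫ ξ in Metric.closedBall 0 1,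
      inner ℂ (fiber S χ f ξ) (fiber S χ g ξ) ∂(haar K) := by
  have h := inner_translate_eq_setIntegral hχ f g 0
  simpa [S.u_zero, translate_zero] using h

theorem ae_inner_fiber_eq_zero (hχ : S.IsStandardCharacter χ) {f g : L2 K}
    (h : ∀ k, inner ℂ (translate (S.u k) f) g = 0) :
    ∀ᵐ ξ ∂((haar K).restrict (Metric.closedBall 0 1)),
      inner ℂ (fiber S χ f ξ) (fiber S χ g ξ) = 0 := by
  refine ae_eq_zero_of_forall_fourierCoeff_eq_zero hχ (integrableOn_inner_fiber hχ f g)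
    fun k => ?_
  rw [← inner_translate_eq_setIntegral hχ, h]

theorem inner_translate_eq_zero (hχ : S.IsStandardCharacter χ) {f g : L2 K}
    (h : ∀ᵐ ξ ∂((haar K).restrict (Metric.closedBall 0 1)),
      inner ℂ (fiber S χ f ξ) (fiber S χ g ξ) = 0) (k : ℕ) :
    inner ℂ (translate (S.u k) f) g = 0 := by
  rw [inner_translate_eq_setIntegral hχ]
  refine integral_eq_zero_of_ae (h.mono fun ξ hξ => ?_)
  simp only [hξ, mul_zero, Pi.zero_apply]

theorem inner_eq_zero_of_ae_inner_fiber (hχ : S.IsStandardCharacter χ) {f g : L2 K}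
    (h : ∀ᵐ ξ ∂((haar K).restrict (Metric.closedBall 0 1)),
      inner ℂ (fiber S χ f ξ) (fiber S χ g ξ) = 0) : inner ℂ f g = 0 := by
  rw [inner_eq_setIntegral hχ]
  exact integral_eq_zero_of_ae h

/-- The translates of `φ` are orthonormal if and only if almost all fibers of `φ` are unit
vectors. -/
theorem orthonormal_translate_iff (hχ : S.IsStandardCharacter χ) (φ : L2 K) :
    Orthonormal ℂ (fun k : ℕ => translate (S.u k) φ) ↔
      ∀ᵐ ξ ∂((haar K).restrict (Metric.closedBall 0 1)),
        inner ℂ (fiber S χ φ ξ) (fiber S χ φ ξ) = (1 : ℂ) := by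
  have hone : IntegrableOn (fun _ : K => (1 : ℂ)) (Metric.closedBall 0 1) (haar K) :=
    integrableOn_const (isCompact_closedBall _ _).measure_lt_top.ne
  constructor
  · intro h
    have h0 := ae_eq_zero_of_forall_fourierCoeff_eq_zero hχ
      (h := fun ξ => inner ℂ (fiber S χ φ ξ) (fiber S χ φ ξ) - 1)
      ((integrableOn_inner_fiber hχ φ φ).sub hone) fun k => ?_
    · exact h0.mono fun ξ hξ => sub_eq_zero.mp hξ
    · have h1 := integrableOn_addChar_mul hχ (S.u k) (integrableOn_inner_fiber hχ φ φ)
      have h2 := integrableOn_addChar_mul hχ (S.u k) hone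
      simp only [mul_sub]
      rw [integral_sub h1 h2, ← inner_translate_eq_setIntegral hχ]
      simp only [mul_one]
      rw [setIntegral_integers_addChar_u hχ, sub_eq_zero]
      have h3 := orthonormal_iff_ite.mp h k 0
      rwa [S.u_zero, translate_zero] at h3
  · intro h
    rw [orthonormal_iff_ite]
    intro k l
    obtain ⟨m, hm⟩ := S.exists_u_add (S.negIndex l) k
    rw [S.u_negIndex] at hm
    rw [inner_translate_right, translate_translate, ← hm, inner_translate_eq_setIntegral hχ]
    have h1 : ∀ᵐ ξ ∂((haar K).restrict (Metric.closedBall 0 1)),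
        (χ (S.u m * ξ) : ℂ) * inner ℂ (fiber S χ φ ξ) (fiber S χ φ ξ) = χ (S.u m * ξ) :=
      h.mono fun ξ hξ => by simp only [hξ, mul_one]
    rw [integral_congr_ae h1, setIntegral_integers_addChar_u hχ]
    refine if_congr ⟨fun h2 => S.u_injective ?_, fun h2 => S.u_injective ?_⟩ rfl rfl
    · rw [h2, S.u_zero] at hm
      exact (neg_add_eq_zero.mp hm.symm).symm
    · rw [hm, h2, S.u_zero, neg_add_cancel]

/-- Fibers can be prescribed by any square integrable function, since the Fourier transform is
surjective. -/
theorem exists_fiber_eq (hχ : S.IsStandardCharacter χ) {H : K → ℂ} (hH : MemLp H 2 (haar K)) :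
    ∃ f : L2 K, ∀ᵐ ξ ∂((haar K).restrict (Metric.closedBall 0 1)),
      ∀ n, fiber S χ f ξ n = H (ξ + S.u n) := by
  refine ⟨(fourierEquiv hχ).symm (hH.toLp H), ?_⟩
  filter_upwards [ae_fiber_apply hχ ((fourierEquiv hχ).symm (hH.toLp H)),
    ae_forall_add_u S hH.coeFn_toLp] with ξ h1 h2 n
  rw [h1, LinearIsometryEquiv.apply_symm_apply, h2]

theorem lintegral_enorm_fiber_sq_lt_top (hχ : S.IsStandardCharacter χ) (f : L2 K) :
    ∫⁻ ξ in Metric.closedBall 0 1, ‖fiber S χ f ξ‖ₑ ^ 2 ∂(haar K) < ∞ := by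
  have hF := (Lp.stronglyMeasurable (fourierEquiv hχ f)).measurable
  have h1 := (memLp_two_iff_lintegral hF).mp (Lp.memLp _)
  rw [lintegral_enorm_sq_eq S hF] at h1
  refine lt_of_eq_of_lt (lintegral_congr_ae ?_) h1
  filter_upwards [ae_memℓp_period S (fourierEquiv hχ f)] with ξ hξ
  rw [fiber_eq_periodFiber hχ, enorm_periodFiber_sq hξ]

end Fibers

/-! ### Scaling functions and the dimension of the range function -/

section Scaling

variable {K : Type*} [NontriviallyNormedField K] [LocallyCompactSpace K] [MeasurableSpace K]
  [BorelSpace K]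

attribute [local instance] secondCountable properSpace

theorem forall_inner_eq_zero_of_dense {V : Submodule ℂ (L2 K)} {g : ℕ → L2 K}
    (hg : closure (Set.range g) = (V : Set (L2 K))) {f : L2 K} (h : ∀ n, inner ℂ (g n) f = 0)
    {v : L2 K} (hv : v ∈ V) : inner ℂ v f = 0 := by
  have hv' : v ∈ closure (Set.range g) := hg ▸ hv
  have hcl : IsClosed {v : L2 K | inner ℂ v f = 0} :=
    isClosed_eq (continuous_id.inner continuous_const) continuous_const
  refine closure_minimal ?_ hcl hv'
  rintro _ ⟨n, rfl⟩
  exact h n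

theorem forall_inner_eq_zero_of_closure_span {V : Submodule ℂ (L2 K)} {e : ℕ → L2 K}
    (he : (Submodule.span ℂ (Set.range e)).topologicalClosure = V) {f : L2 K}
    (h : ∀ n, inner ℂ (e n) f = 0) {v : L2 K} (hv : v ∈ V) : inner ℂ v f = 0 := by
  rw [← Submodule.mem_orthogonal_singleton_iff_inner_left]
  rw [← he] at hv
  refine Submodule.topologicalClosure_minimal _ ?_ (Submodule.isClosed_orthogonal _) hv
  rw [Submodule.span_le]
  rintro _ ⟨n, rfl⟩
  exact (Submodule.mem_orthogonal_singleton_iff_inner_left).mpr (h n)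

variable [IsUltrametricDist K] {p c : ℕ} [Fact p.Prime] [CharP K p] {S : TranslationData K p c}
  {χ : AddChar K Circle}

/-- The pointwise projection of the fibers of `g` to the complement of the fibers of `φ` is again
given by the fibers of a function in `L²(K)`. -/
theorem exists_fiber_eq_sub_smul (hχ : S.IsStandardCharacter χ) {φ : L2 K}
    (hφ : ∀ᵐ ξ ∂((haar K).restrict (Metric.closedBall 0 1)),
      inner ℂ (fiber S χ φ ξ) (fiber S χ φ ξ) = (1 : ℂ)) (g : L2 K) :
    ∃ f : L2 K, ∀ᵐ ξ ∂((haar K).restrict (Metric.closedBall 0 1)),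
      fiber S χ f ξ =
        fiber S χ g ξ - (inner ℂ (fiber S χ φ ξ) (fiber S χ g ξ) : ℂ) • fiber S χ φ ξ := by
  set P : K → ℂ := ((fourierEquiv hχ φ : L2 K) : K → ℂ) with hP
  set G : K → ℂ := ((fourierEquiv hχ g : L2 K) : K → ℂ)
  have hPm : Measurable P := (Lp.stronglyMeasurable _).measurable
  have hGm : Measurable G := (Lp.stronglyMeasurable _).measurable
  -- The coefficient, as a function that is periodic with respect to the translation set.
  set a : K → ℂ := fun x => ∑' m, inner ℂ (P (x + S.u m)) (G (x + S.u m)) with ha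
  have ham : Measurable a := Measurable.tsum fun m =>
    (hPm.comp (measurable_add_const _)).inner (hGm.comp (measurable_add_const _))
  have haper : ∀ x n, a (x + S.u n) = a x := fun x n =>
    tsum_add_u_add_u S (fun y => (inner ℂ (P y) (G y) : ℂ)) x n
  have haP : MemLp (fun x => a x * P x) 2 (haar K) := by
    refine memLp_of_lintegral_periodFiber S (ham.mul hPm)
      (lt_of_le_of_lt (lintegral_mono_ae ?_) (lintegral_enorm_fiber_sq_lt_top (S := S) hχ g))
    filter_upwards [ae_memℓp_period S (fourierEquiv hχ φ), ae_inner_fiber hχ φ g, hφ]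
      with ξ h1 h2 h3
    have hnorm : ‖fiber S χ φ ξ‖ = 1 := by
      have : ‖fiber S χ φ ξ‖ ^ 2 = 1 := by
        rw [← inner_self_eq_norm_sq (𝕜 := ℂ), h3, RCLike.one_re]
      exact (pow_eq_one_iff_of_nonneg (norm_nonneg _) two_ne_zero).mp this
    have henorm : ‖fiber S χ φ ξ‖ₑ = 1 := by rw [← ofReal_norm, hnorm, ENNReal.ofReal_one]
    simp only [haper, enorm_mul, mul_pow]
    rw [ENNReal.tsum_mul_left, hP, ← enorm_periodFiber_sq h1, ← fiber_eq_periodFiber hχ, henorm,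
      one_pow, mul_one]
    have h4 : a ξ = inner ℂ (fiber S χ φ ξ) (fiber S χ g ξ) := h2.symm
    rw [h4, ← ofReal_norm, ← ofReal_norm]
    gcongr
    refine (norm_inner_le_norm _ _).trans ?_
    rw [hnorm, one_mul]
  obtain ⟨f, hf⟩ := exists_fiber_eq hχ ((Lp.memLp (fourierEquiv hχ g)).sub haP)
  refine ⟨f, ?_⟩
  filter_upwards [hf, ae_fiber_apply hχ φ, ae_fiber_apply hχ g, ae_inner_fiber hχ φ g]
    with ξ h1 h2 h3 h4
  ext n
  have h5 : a ξ = inner ℂ (fiber S χ φ ξ) (fiber S χ g ξ) := h4.symm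
  rw [h1, lp.coeFn_sub, Pi.sub_apply, Pi.sub_apply, lp.coeFn_smul, Pi.smul_apply, h2, h3, haper,
    h5, smul_eq_mul]

section ScalingFunction

variable {V : Submodule ℂ (L2 K)} {φ : L2 K}

/-- Fibers of elements of `V` are multiples of the fibers of a scaling function. -/
theorem ae_fiber_eq_smul_of_mem (hχ : S.IsStandardCharacter χ)
    (hφ : ∀ᵐ ξ ∂((haar K).restrict (Metric.closedBall 0 1)),
      inner ℂ (fiber S χ φ ξ) (fiber S χ φ ξ) = (1 : ℂ))
    (hV : (Submodule.span ℂ (Set.range fun k : ℕ => translate (S.u k) φ)).topologicalClosure = V)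
    {g : L2 K} (hg : ∀ k, translate (S.u k) g ∈ V) :
    ∀ᵐ ξ ∂((haar K).restrict (Metric.closedBall 0 1)),
      fiber S χ g ξ = (inner ℂ (fiber S χ φ ξ) (fiber S χ g ξ) : ℂ) • fiber S χ φ ξ := by
  obtain ⟨f, hf⟩ := exists_fiber_eq_sub_smul hχ hφ g
  have hφf : ∀ᵐ ξ ∂((haar K).restrict (Metric.closedBall 0 1)),
      inner ℂ (fiber S χ φ ξ) (fiber S χ f ξ) = 0 := by
    filter_upwards [hf, hφ] with ξ h1 h2
    rw [h1, inner_sub_right, inner_smul_right, h2, mul_one, sub_self]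
  -- `f` is orthogonal to the translates of `φ`, hence to `V`, which contains those of `g`.
  have hgf := ae_inner_fiber_eq_zero hχ (f := g) (g := f) fun k =>
    forall_inner_eq_zero_of_closure_span hV (inner_translate_eq_zero hχ hφf) (hg k)
  filter_upwards [hf, hφf, hgf] with ξ h1 h2 h3
  have h4 : fiber S χ f ξ = 0 := by
    rw [← inner_self_eq_zero (𝕜 := ℂ)]
    refine (congrArg (fun v => inner ℂ v (fiber S χ f ξ)) h1).trans ?_
    rw [inner_sub_left, h3, inner_smul_left, h2, mul_zero, sub_zero]
  rw [h4] at h1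
  exact sub_eq_zero.mp h1.symm

/-- The fibers of a dense sequence in `V` cannot all vanish at a point, up to a null set: otherwise
the fibers of `φ`, cut off to the set where they do, would be orthogonal to `V`. -/
theorem ae_exists_fiber_ne_zero (hχ : S.IsStandardCharacter χ)
    (hφ : ∀ᵐ ξ ∂((haar K).restrict (Metric.closedBall 0 1)),
      inner ℂ (fiber S χ φ ξ) (fiber S χ φ ξ) = (1 : ℂ))
    (hφV : ∀ k, translate (S.u k) φ ∈ V)
    {g : ℕ → L2 K} (hg : closure (Set.range g) = (V : Set (L2 K))) :
    ∀ᵐ ξ ∂((haar K).restrict (Metric.closedBall 0 1)), ∃ n, fiber S χ (g n) ξ ≠ 0 := by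
  -- Restrict the transform of `φ` to the set `E` over which all the fibers of the `g n` vanish.
  set E : Set K := {x | ∀ n m, fourierEquiv hχ (g n) (x + S.u m) = 0} with hE
  have hEm : MeasurableSet E := by
    have : E = ⋂ n, ⋂ m, {x | fourierEquiv hχ (g n) (x + S.u m) = 0} := by
      ext x
      simp [hE]
    rw [this]
    refine MeasurableSet.iInter fun n => MeasurableSet.iInter fun m => ?_
    exact ((Lp.stronglyMeasurable (fourierEquiv hχ (g n))).measurable.comp
      (measurable_add_const (S.u m))) (measurableSet_singleton 0)
  have hEper : ∀ x ∈ E, ∀ j, x + S.u j ∈ E := fun x hx j n m => by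
    rw [add_assoc, ← S.u_addIndexEquiv]
    exact hx n _
  have hEper' : ∀ x j, x + S.u j ∈ E → x ∈ E := fun x j hx n m => by
    have := hEper _ hx (S.negIndex j) n m
    rwa [S.u_negIndex, add_neg_cancel_right] at this
  obtain ⟨f, hf⟩ := exists_fiber_eq hχ ((Lp.memLp (fourierEquiv hχ φ)).indicator hEm)
  have hgf : ∀ n, ∀ᵐ ξ ∂((haar K).restrict (Metric.closedBall 0 1)),
      inner ℂ (fiber S χ (g n) ξ) (fiber S χ f ξ) = 0 := fun n => by
    filter_upwards [hf, ae_fiber_apply hχ (g n)] with ξ h1 h2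
    rw [lp.inner_eq_tsum]
    refine (tsum_congr fun m => ?_).trans tsum_zero
    rw [h1, h2]
    by_cases hξ : ξ + S.u m ∈ E
    · rw [hEper' ξ m hξ n m, inner_zero_left]
    · rw [Set.indicator_of_notMem hξ, inner_zero_right]
  have hφf := ae_inner_fiber_eq_zero hχ (f := φ) (g := f) fun k =>
    forall_inner_eq_zero_of_dense hg (fun n => inner_eq_zero_of_ae_inner_fiber hχ (hgf n)) (hφV k)
  filter_upwards [hf, hφf, hφ, ae_fiber_apply hχ φ, ae_all_iff.mpr fun n => ae_fiber_apply hχ (g n)]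
    with ξ h1 h2 h3 h4 h5
  by_contra! hcon
  have hξ : ξ ∈ E := fun n m => by rw [← h5, hcon, lp.coeFn_zero, Pi.zero_apply]
  have h6 : fiber S χ f ξ = fiber S χ φ ξ := by
    ext m
    rw [h1, h4, Set.indicator_of_mem (hEper ξ hξ m)]
  rw [h6, h3] at h2
  exact one_ne_zero h2

/-- If the translates of `φ` form an orthonormal basis of `V`, the range function of `V` is
spanned by the fibers of `φ`. -/
theorem ae_rank_eq_one_of_scaling (hχ : S.IsStandardCharacter χ)
    (hφ : Orthonormal ℂ (fun k : ℕ => translate (S.u k) φ))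
    (hV : (Submodule.span ℂ (Set.range fun k : ℕ => translate (S.u k) φ)).topologicalClosure = V)
    (hVt : ∀ k, ∀ f ∈ V, translate (S.u k) f ∈ V)
    {g : ℕ → L2 K} (hg : closure (Set.range g) = (V : Set (L2 K))) :
    ∀ᵐ ξ ∂((haar K).restrict (Metric.closedBall 0 1)),
      Module.rank ℂ (Submodule.span ℂ
        (Set.range fun n => fiber S χ (g n) ξ)).topologicalClosure = 1 := by
  rw [orthonormal_translate_iff hχ] at hφ
  have hgV : ∀ n, g n ∈ V := fun n => by
    have : g n ∈ closure (Set.range g) := subset_closure ⟨n, rfl⟩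
    rwa [hg] at this
  have hφV : ∀ k, translate (S.u k) φ ∈ V := fun k =>
    hV ▸ Submodule.le_topologicalClosure _ (Submodule.subset_span ⟨k, rfl⟩)
  filter_upwards [hφ, ae_exists_fiber_ne_zero hχ hφ hφV hg,
    ae_all_iff.mpr fun n => ae_fiber_eq_smul_of_mem hχ hφ hV (g := g n) fun k => hVt k _ (hgV n)]
    with ξ h1 ⟨n, hn⟩ h2
  rw [rank_submodule_eq_one_iff]
  refine ⟨_, Submodule.le_topologicalClosure _ (Submodule.subset_span ⟨n, rfl⟩), hn, ?_⟩
  refine Submodule.topologicalClosure_minimal _ ?_ (Submodule.closed_of_finiteDimensional _)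
  rw [Submodule.span_le]
  rintro _ ⟨m, rfl⟩
  rw [SetLike.mem_coe, Submodule.mem_span_singleton]
  have hne : (inner ℂ (fiber S χ φ ξ) (fiber S χ (g n) ξ) : ℂ) ≠ 0 := fun h3 => by
    rw [h2 n, h3, zero_smul] at hn
    exact hn rfl
  refine ⟨inner ℂ (fiber S χ φ ξ) (fiber S χ (g m) ξ) *
    (inner ℂ (fiber S χ φ ξ) (fiber S χ (g n) ξ))⁻¹, ?_⟩
  show _ • fiber S χ (g n) ξ = fiber S χ (g m) ξ
  conv_rhs => rw [h2 m]
  conv_lhs => rw [h2 n]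
  simp only [inner_smul_right, h1, mul_one]
  rw [smul_smul, inv_mul_cancel_right₀ hne]

end ScalingFunction

/-- A measurable choice of unit vectors: among the fibers of a sequence, take at every point the
first one that does not vanish, and normalise it. -/
theorem exists_normalised_fiber (hχ : S.IsStandardCharacter χ) (g : ℕ → L2 K)
    (hg : ∀ᵐ ξ ∂((haar K).restrict (Metric.closedBall 0 1)), ∃ n, fiber S χ (g n) ξ ≠ 0) :
    ∃ φ : L2 K, ∀ᵐ ξ ∂((haar K).restrict (Metric.closedBall 0 1)),
      inner ℂ (fiber S χ φ ξ) (fiber S χ φ ξ) = (1 : ℂ) ∧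
        ∃ n, ∃ r : ℂ, fiber S χ φ ξ = r • fiber S χ (g n) ξ := by
  classical
  set G : ℕ → K → ℂ := fun n => fourierEquiv hχ (g n) with hG
  have hGm : ∀ n, Measurable (G n) := fun n => (Lp.stronglyMeasurable _).measurable
  have hNm : ∀ n, Measurable (periodNorm S (G n)) := fun n => measurable_periodNorm (hGm n)
  -- The second alternative makes the search total; it occurs on a null set only.
  have hex : ∀ x, ∃ n, periodNorm S (G n) x ≠ 0 ∨ ∀ m, periodNorm S (G m) x = 0 := fun x => by
    by_cases h : ∀ m, periodNorm S (G m) x = 0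
    · exact ⟨0, Or.inr h⟩
    · push Not at h
      exact h.imp fun n hn => Or.inl hn
  set H : K → ℂ := fun x =>
    ((periodNorm S (G (Nat.find (hex x))) x)⁻¹ : ℂ) * G (Nat.find (hex x)) x with hH
  have hHm : Measurable H := by
    refine Measurable.find (f := fun n x => ((periodNorm S (G n) x)⁻¹ : ℂ) * G n x)
      (fun n => (Complex.measurable_ofReal.comp (hNm n)).inv.mul (hGm n)) (fun n => ?_) hex
    have : {x | periodNorm S (G n) x ≠ 0 ∨ ∀ m, periodNorm S (G m) x = 0} =
        periodNorm S (G n) ⁻¹' {0}ᶜ ∪ ⋂ m, periodNorm S (G m) ⁻¹' {0} := by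
      ext x
      simp
    rw [this]
    exact ((hNm n) (measurableSet_singleton 0).compl).union
      (MeasurableSet.iInter fun m => (hNm m) (measurableSet_singleton 0))
  have hHper : ∀ ξ m, H (ξ + S.u m) =
      ((periodNorm S (G (Nat.find (hex ξ))) ξ)⁻¹ : ℂ) * G (Nat.find (hex ξ)) (ξ + S.u m) :=
    fun ξ m => by
      simp only [hH, periodNorm_add_u]
  have hae : ∀ᵐ ξ ∂((haar K).restrict (Metric.closedBall 0 1)),
      (∀ m, H (ξ + S.u m) = (((periodNorm S (G (Nat.find (hex ξ))) ξ)⁻¹ : ℂ) •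
        fiber S χ (g (Nat.find (hex ξ))) ξ) m) ∧
      ‖((periodNorm S (G (Nat.find (hex ξ))) ξ)⁻¹ : ℂ) •
        fiber S χ (g (Nat.find (hex ξ))) ξ‖ = 1 := by
    filter_upwards [hg, ae_all_iff.mpr fun n => ae_memℓp_period S (fourierEquiv hχ (g n)),
      ae_all_iff.mpr fun n => ae_fiber_apply hχ (g n)] with ξ ⟨n, hn⟩ h2 h3
    have hnorm : ∀ n, ‖fiber S χ (g n) ξ‖ = periodNorm S (G n) ξ := fun n => by
      rw [fiber_eq_periodFiber hχ, norm_periodFiber (h2 n)]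
    refine ⟨fun m => ?_, ?_⟩
    · rw [hHper, lp.coeFn_smul, Pi.smul_apply, h3, smul_eq_mul]
    · have hne : periodNorm S (G (Nat.find (hex ξ))) ξ ≠ 0 :=
        (Nat.find_spec (hex ξ)).resolve_right fun h4 => hn (norm_eq_zero.mp (by rw [hnorm, h4]))
      have hnonneg : 0 ≤ periodNorm S (G (Nat.find (hex ξ))) ξ := Real.sqrt_nonneg _
      rw [norm_smul, hnorm, norm_inv, Complex.norm_real, Real.norm_of_nonneg hnonneg]
      exact inv_mul_cancel₀ hne
  have hHL : MemLp H 2 (haar K) := by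
    refine memLp_of_lintegral_periodFiber S hHm
      (lt_of_eq_of_lt (b := ∫⁻ ξ in Metric.closedBall (0 : K) 1, 1 ∂(haar K))
        (lintegral_congr_ae ?_) ?_)
    · filter_upwards [hae] with ξ ⟨h1, h2⟩
      have h3 : Memℓp (fun m => H (ξ + S.u m)) 2 := by
        simp only [h1]
        exact lp.memℓp _
      have h4 : periodFiber S H ξ = ((periodNorm S (G (Nat.find (hex ξ))) ξ)⁻¹ : ℂ) •
          fiber S χ (g (Nat.find (hex ξ))) ξ := by
        ext m
        rw [periodFiber_apply h3, h1]
      rw [← enorm_periodFiber_sq h3, h4, ← ofReal_norm, h2, ENNReal.ofReal_one, one_pow]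
    · simp [haar_integers]
  obtain ⟨φ, hφ⟩ := exists_fiber_eq hχ hHL
  refine ⟨φ, ?_⟩
  filter_upwards [hφ, hae] with ξ h1 ⟨h2, h3⟩
  have h4 : fiber S χ φ ξ = ((periodNorm S (G (Nat.find (hex ξ))) ξ)⁻¹ : ℂ) •
      fiber S χ (g (Nat.find (hex ξ))) ξ := by
    ext m
    rw [h1, h2]
  refine ⟨?_, _, _, h4⟩
  rw [inner_self_eq_norm_sq_to_K, h4, h3]
  simp

/-- If the range function of a closed translation invariant space has dimension one almost
everywhere, then the space has a scaling function. -/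
theorem exists_scaling_of_ae_rank_eq_one (hχ : S.IsStandardCharacter χ)
    {V : Submodule ℂ (L2 K)} (hVc : IsClosed (V : Set (L2 K)))
    (hVt : ∀ k, ∀ f ∈ V, translate (S.u k) f ∈ V)
    {g : ℕ → L2 K} (hg : closure (Set.range g) = (V : Set (L2 K)))
    (hrank : ∀ᵐ ξ ∂((haar K).restrict (Metric.closedBall 0 1)),
      Module.rank ℂ (Submodule.span ℂ
        (Set.range fun n => fiber S χ (g n) ξ)).topologicalClosure = 1) :
    ∃ φ ∈ V, Orthonormal ℂ (fun k : ℕ => translate (S.u k) φ) ∧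
      (Submodule.span ℂ (Set.range fun k : ℕ => translate (S.u k) φ)).topologicalClosure = V := by
  have hgV : ∀ n, g n ∈ V := fun n => by
    have : g n ∈ closure (Set.range g) := subset_closure ⟨n, rfl⟩
    rwa [hg] at this
  have hne : ∀ᵐ ξ ∂((haar K).restrict (Metric.closedBall 0 1)),
      ∃ n, fiber S χ (g n) ξ ≠ 0 := by
    filter_upwards [hrank] with ξ h
    by_contra! hcon
    obtain ⟨v, hv, hv0, -⟩ := (rank_submodule_eq_one_iff _).mp h
    refine hv0 ((Submodule.mem_bot ℂ).mp
      (Submodule.topologicalClosure_minimal _ ?_ (Submodule.closed_of_finiteDimensional _) hv))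
    rw [Submodule.span_le]
    rintro _ ⟨n, rfl⟩
    exact hcon n
  obtain ⟨φ, hφ⟩ := exists_normalised_fiber hχ g hne
  -- All fibers of the `g n` are multiples of those of `φ`.
  have hmul : ∀ᵐ ξ ∂((haar K).restrict (Metric.closedBall 0 1)),
      ∀ n, ∃ b : ℂ, fiber S χ (g n) ξ = b • fiber S χ φ ξ := by
    filter_upwards [hrank, hφ] with ξ h ⟨h1, m, r, h2⟩ n
    obtain ⟨v, -, -, hle⟩ := (rank_submodule_eq_one_iff _).mp h
    have hspan : ∀ n, ∃ a : ℂ, a • v = fiber S χ (g n) ξ := fun n =>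
      Submodule.mem_span_singleton.mp
        (hle (Submodule.le_topologicalClosure _ (Submodule.subset_span ⟨n, rfl⟩)))
    obtain ⟨a, ha⟩ := hspan m
    obtain ⟨b, hb⟩ := hspan n
    rw [← ha, smul_smul] at h2
    have hra : r * a ≠ 0 := fun h3 => by
      rw [h2, h3, zero_smul, inner_zero_left] at h1
      exact zero_ne_one h1
    exact ⟨b * (r * a)⁻¹, by rw [h2, smul_smul, inv_mul_cancel_right₀ hra, hb]⟩
  have hcV : CompleteSpace V := hVc.completeSpace_coe
  have hφV : φ ∈ V := by
    rw [← V.orthogonal_orthogonal, Submodule.mem_orthogonal']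
    intro f hf
    have h1 : ∀ᵐ ξ ∂((haar K).restrict (Metric.closedBall 0 1)),
        ∀ n, inner ℂ (fiber S χ (g n) ξ) (fiber S χ f ξ) = 0 :=
      ae_all_iff.mpr fun n => ae_inner_fiber_eq_zero hχ fun k =>
        (Submodule.mem_orthogonal _ _).mp hf _ (hVt k _ (hgV n))
    refine inner_eq_zero_of_ae_inner_fiber hχ ?_
    filter_upwards [h1, hφ] with ξ h2 ⟨_, n, r, h3⟩
    rw [h3, inner_smul_left, h2, mul_zero]
  refine ⟨φ, hφV, (orthonormal_translate_iff hχ φ).mpr (hφ.mono fun ξ h => h.1), ?_⟩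
  refine le_antisymm (Submodule.topologicalClosure_minimal _ ?_ hVc) fun f hf => ?_
  · rw [Submodule.span_le]
    rintro _ ⟨k, rfl⟩
    exact hVt k φ hφV
  · set M : Submodule ℂ (L2 K) :=
      (Submodule.span ℂ (Set.range fun k : ℕ => translate (S.u k) φ)).topologicalClosure with hM
    have hc : CompleteSpace M := (Submodule.isClosed_topologicalClosure _).completeSpace_coe
    obtain ⟨y, hy, z, hz, rfl⟩ := M.exists_add_mem_mem_orthogonal f
    have hyV : y ∈ V := by
      refine Submodule.topologicalClosure_minimal _ ?_ hVc hy
      rw [Submodule.span_le]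
      rintro _ ⟨k, rfl⟩
      exact hVt k φ hφV
    have hzV : z ∈ V := by simpa using V.sub_mem hf hyV
    have h1 := ae_inner_fiber_eq_zero hχ (f := φ) (g := z) fun k =>
      (Submodule.mem_orthogonal _ _).mp hz _
        (Submodule.le_topologicalClosure _ (Submodule.subset_span ⟨k, rfl⟩))
    have h2 : ∀ n, inner ℂ (g n) z = 0 := fun n => by
      refine inner_eq_zero_of_ae_inner_fiber hχ ?_
      filter_upwards [h1, hmul] with ξ h3 h4
      obtain ⟨b, hb⟩ := h4 n
      rw [hb, inner_smul_left, h3, mul_zero]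
    have h3 : z = 0 := by
      rw [← inner_self_eq_zero (𝕜 := ℂ)]
      exact forall_inner_eq_zero_of_dense hg h2 hzV
    rwa [h3, add_zero]

end Scaling

end LocalFieldWavelet

open LocalFieldWavelet in
theorem theorem3p3p5 {K : Type*} [NontriviallyNormedField K] [IsUltrametricDist K]
    [LocallyCompactSpace K] [MeasurableSpace K] [BorelSpace K]
    {p c : ℕ} [Fact p.Prime] [CharP K p]
    (S : TranslationData K p c) (χ : AddChar K Circle) (hχ : S.IsStandardCharacter χ)
    (Ψ : Fin (S.q - 1) → L2 K) (hΨ : IsOrthonormalMultiwavelet S Ψ)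
    (m : K → ℕ∞) (hm : IsMultiplicityFunction S χ (negativeDilates S Ψ) m) :
    IsAssociatedWithMRA S Ψ ↔
      ∀ᵐ ξ ∂((haar K).restrict (Metric.closedBall 0 1)), m ξ = 1 := by
  obtain ⟨J, ⟨g, hg, hJ⟩, hmJ⟩ := hm
  have hrank : (∀ᵐ ξ ∂((haar K).restrict (Metric.closedBall 0 1)), m ξ = 1) ↔
      ∀ᵐ ξ ∂((haar K).restrict (Metric.closedBall 0 1)), Module.rank ℂ (Submodule.span ℂ
        (Set.range fun n => fiber S χ (g n) ξ)).topologicalClosure = 1 := by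
    refine eventually_congr ?_
    filter_upwards [hJ, hmJ] with ξ h1 h2
    rw [h2, h1, Cardinal.toENat_eq_one]
  rw [hrank, isAssociatedWithMRA_iff hΨ]
  constructor
  · rintro ⟨φ, -, hφ, hV⟩
    exact ae_rank_eq_one_of_scaling hχ hφ hV
      (fun k f hf => translate_mem_negativeDilates hΨ k hf) hg
  · exact exists_scaling_of_ae_rank_eq_one hχ (Submodule.isClosed_topologicalClosure _)
      (fun k f hf => translate_mem_negativeDilates hΨ k hf) hg
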